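/- **Setting.** Let $f:[0,1]^d\to\mathbb{R}^m$. For $x\in[0,1]^d$ let $Q_n(x)\in\{0,1\}^{dn}$ be the code obtained by truncating each coordinate to $n$ bits, and for a code $u$ let $Q_n^{-1}(u)$ be the grid point that it represents (each coordinate of the form $k/2^n$, $0\le k<2^n$). Outputs are codes $y\in\{0,1\}^{m\,m_{\rm out}}$, decoded in a fixed-point format: $\mathsf{Dec}(y)_j = a_j+b_j\,k_j/2^{m_{\rm out}}$, where $k_j$ is the integer coded by the $j$-th block of $m_{\rm out}$ bits and $a_j,b_j$ are fixed reals. A *finite-precision family* of $f$ is a family of maps $F_{n,m_{\rm out}}:\{0,1\}^{dn}\to\{0,1\}^{m\,m_{\rm out}}$ with $\|\mathsf{Dec}(F_{n,m_{\rm out}}(u))-f(Q_n^{-1}(u))\|_\infty\le 2^{-m_{\rm out}}$ for all $n,m_{\rm out},u$; that is, $F_{n,m_{\rm out}}=Q^{\rm out}_{m_{\rm out}}\circ f\circ Q_n^{-1}$ for some rounding to $m_{\rm out}$ bits of this accuracy. $f$ is *efficiently Turing computable* with finite-precision family $(F_{n,m_{\rm out}})$ if one deterministic Turing machine, given $u$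 and $m_{\rm out}$ (in unary), outputs $F_{n,m_{\rm out}}(u)$ within $p(n+m_{\rm out})$ steps for some polynomial $p$. A *computation DAG* for $F_{n,m_{\rm out}}$ consists of $dn$ input nodes and $s$ internal nodes in topological order, each a Boolean gate of fan-in at most $3$, the last $m\,m_{\rm out}$ of them being the outputs. Its *trace* on $u$ is the sequence of the $dn$ input bits followed by the $s$ gate values. A *(3-sparse) linear autoregressive predictor* consists, for each position $t=1,\dots,s$, of a linear threshold function of the whole prefix of length $dn+t-1$ with real weights, at most three of them nonzero; given a prompt $u$ it generates $s$ tokens one after another, each from the prompt and the tokens generated before, and its answer $\hat F(u)$ is the last $m\,m_{\rm out}$ tokens. It *fits* a set of sequences if it predicts every one of their tokens after the prompt correctly from the preceding tokens. **Theorem (autoregressive learnability via compositional sparsity).** There are one training algorithm $A$ (a random access machine program with unit-cost instructions and no multiplication, whose input is a list of binary sequences and the numbers: how many sequences, prompt length, number of generated tokens) and one polynomial $P$ such that the following holds for all $d$, $m$ and every efficiently Turing computable $f:[0,1]^d\to\mathbb{R}^m$ with finite-precision family $(F_{n,m_{\rm out}})$. There are a polynomial $q$ and, for all $(n,m_{\rm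 out})$, a computation DAG for $F_{n,m_{\rm out}}$ with $s=s(n,m_{\rm out})\le q(n+m_{\rm out})$ internal nodes and depth at most $q(n+m_{\rm out})$, and a dataset $\mathcal D_{n,m_{\rm out}}$, namely a probability distribution on traces of this DAG, such that for every $\delta\in(0,1)$ there is a sample size $$M\le P\big(s+\lceil\log(1/\delta)\rceil+m_{\rm out}\big)$$ with these properties. 1. (Training time.) On any $M$ sequences from the support of $\mathcal D_{n,m_{\rm out}}$, $A$ outputs within $P(s+\lceil\log(1/\delta)\rceil+m_{\rm out})$ steps a 3-sparse linear autoregressive predictor that fits them. 2. (Learning.) For every $M'\ge M$, with probability at least $1-\delta$ over $M'$ i.i.d. samples from $\mathcal D_{n,m_{\rm out}}$, every 3-sparse linear autoregressive predictor that fits the samples (in particular, for $M'=M$, the one trained by $A$) satisfies $\hat F(u)=F_{n,m_{\rm out}}(u)$ for all $u\in\{0,1\}^{dn}$. 3. (Neural approximant.) On the same event, for each such predictor there is a ReLU network $\Phi_{n,m_{\rm out}}$ of size (units and connections) and depth at most $q(n+m_{\rm out})$ that realizes the composition of its next-token predictors, $\Phi_{n,m_{\rm out}}(u)=\mathsf{Dec}(\hat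 F(u))$ for all $u\in\{0,1\}^{dn}$, and hence $$\big\|\Phi_{n,m_{\rm out}}(Q_n(x))-f(Q_n^{-1}(Q_n(x)))\big\|_\infty\le 2^{-m_{\rm out}}\qquad\text{for all }x\in[0,1]^d.$$ -/

import Mathlib

open MeasureTheory

namespace ARLearn

noncomputable section

/-! ### Finite precision -/

/-- A code for a vector with `d` coordinates, `n` bits per coordinate. Bit `i` of coordinate `j`
(least significant bit first) is stored at position `finProdFinEquiv (j, i)`. -/
abbrev Code (d n : ℕ) : Type := Fin (d * n) → Bool

/-- The `n`-bit code of coordinate `j`. -/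
def Code.coord {d n : ℕ} (u : Code d n) (j : Fin d) : Fin n → Bool :=
  fun i => u (finProdFinEquiv (j, i))

/-- The number `k / 2 ^ n` in `[0, 1)` represented by `n` bits. -/
def bitValue {n : ℕ} (c : Fin n → Bool) : ℝ := (Nat.ofBits c : ℝ) / 2 ^ n

/-- The `n`-bit truncation of a number of `[0, 1]` (the value `1` goes to the last cell). -/
def truncBits (n : ℕ) (t : ℝ) : Fin n → Bool :=
  fun i => (min ⌊(2 : ℝ) ^ n * t⌋₊ (2 ^ n - 1)).testBit i

theorem bitValue_mem {n : ℕ} (c : Fin n → Bool) : bitValue c ∈ Set.Icc (0 : ℝ) 1 := by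
  have h : (Nat.ofBits c : ℝ) < 2 ^ n := by exact_mod_cast Nat.ofBits_lt_two_pow c
  exact ⟨by unfold bitValue; positivity, (div_le_one (by positivity)).2 h.le⟩

/-- The input quantizer `Q_n`. -/
def inQuant {d : ℕ} (n : ℕ) (x : Fin d → unitInterval) : Code d n :=
  fun k => truncBits n (x (finProdFinEquiv.symm k).1) (finProdFinEquiv.symm k).2

/-- `Q_n⁻¹`: the point of the `n`-bit grid of `[0,1]^d` with a given code. -/
def gridPoint {d n : ℕ} (u : Code d n) : Fin d → unitInterval :=
  fun j => ⟨bitValue (u.coord j), bitValue_mem _⟩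

/-- The output decoder: fixed-point numbers, coordinate `j` ranging over
`[lo j, lo j + width j)`. -/
def outDecode {m : ℕ} (lo width : Fin m → ℝ) {mo : ℕ} (y : Code m mo) : Fin m → ℝ :=
  fun j => lo j + width j * bitValue (y.coord j)

/-- The truncating output quantizer of the same fixed-point format. -/
def outQuant {m : ℕ} (lo width : Fin m → ℝ) (mo : ℕ) (v : Fin m → ℝ) : Code m mo :=
  fun k => truncBits mo
    ((v (finProdFinEquiv.symm k).1 - lo (finProdFinEquiv.symm k).1) /
      width (finProdFinEquiv.symm k).1) (finProdFinEquiv.symm k).2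

/-- A finite-precision family `F n mo = Q^out_mo ∘ f ∘ Q_n⁻¹` of `f`: the value of `f` at each grid
point is replaced by an `mo`-bit code that decodes to it up to `2 ^ (-mo)`. Every rounding rule with
this accuracy is admitted; see `isPrecisionFamily_outQuant` for truncation. The norm on
`Fin m → ℝ` is the maximum norm. -/
def IsPrecisionFamily {d m : ℕ} (lo width : Fin m → ℝ)
    (f : (Fin d → unitInterval) → (Fin m → ℝ))
    (F : (n mo : ℕ) → Code d n → Code m mo) : Prop :=
  ∀ (n mo : ℕ) (u : Code d n),
    ‖outDecode lo width (F n mo u) - f (gridPoint u)‖ ≤ (2 : ℝ)⁻¹ ^ mo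

theorem ofBits_truncBits (n : ℕ) (t : ℝ) :
    Nat.ofBits (truncBits n t) = min ⌊(2 : ℝ) ^ n * t⌋₊ (2 ^ n - 1) := by
  unfold truncBits
  rw [Nat.ofBits_testBit]
  apply Nat.mod_eq_of_lt
  have := Nat.two_pow_pos n
  omega

theorem abs_bitValue_truncBits_sub_le (n : ℕ) {t : ℝ} (h0 : 0 ≤ t) (h1 : t ≤ 1) :
    |bitValue (truncBits n t) - t| ≤ (2 : ℝ)⁻¹ ^ n := by
  have hp : (0 : ℝ) < 2 ^ n := by positivity
  have e : bitValue (truncBits n t) - t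
      = (2 : ℝ)⁻¹ ^ n * ((Nat.ofBits (truncBits n t) : ℝ) - 2 ^ n * t) := by
    unfold bitValue; rw [inv_pow]; field_simp
  rw [e, abs_mul, abs_of_pos (by positivity : (0 : ℝ) < (2 : ℝ)⁻¹ ^ n)]
  refine mul_le_of_le_one_right (by positivity) ?_
  rw [ofBits_truncBits]
  have hf1 := Nat.floor_le (mul_nonneg hp.le h0)
  have hf2 := Nat.lt_floor_add_one ((2 : ℝ) ^ n * t)
  have hle : (2 : ℝ) ^ n * t ≤ 2 ^ n := mul_le_of_le_one_right hp.le h1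
  rcases le_total ⌊(2 : ℝ) ^ n * t⌋₊ (2 ^ n - 1) with h | h
  · rw [min_eq_left h, abs_le]; constructor <;> linarith
  · rw [min_eq_right h]
    have h3 : ((2 ^ n - 1 : ℕ) : ℝ) = 2 ^ n - 1 := by
      rw [Nat.cast_sub Nat.one_le_two_pow]; simp
    have h4 : ((2 ^ n - 1 : ℕ) : ℝ) ≤ (⌊(2 : ℝ) ^ n * t⌋₊ : ℝ) := by exact_mod_cast h
    rw [h3] at h4 ⊢
    rw [abs_le]; constructor <;> linarith

/-- For `f` with values in the representable range, `Q^out ∘ f ∘ Q_n⁻¹` with the truncating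
quantizer `Q^out` is a finite-precision family of `f`. -/
theorem isPrecisionFamily_outQuant {d m : ℕ} {lo width : Fin m → ℝ}
    {f : (Fin d → unitInterval) → (Fin m → ℝ)} (hw : ∀ j, 0 < width j ∧ width j ≤ 1)
    (hf : ∀ x j, lo j ≤ f x j ∧ f x j ≤ lo j + width j) :
    IsPrecisionFamily lo width f fun _ mo u => outQuant lo width mo (f (gridPoint u)) := by
  intro n mo u
  rw [pi_norm_le_iff_of_nonneg (by positivity)]
  intro j
  obtain ⟨hw0, hw1⟩ := hw j
  obtain ⟨h1, h2⟩ := hf (gridPoint u) j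
  have hc : (outQuant lo width mo (f (gridPoint u))).coord j
      = truncBits mo ((f (gridPoint u) j - lo j) / width j) := by
    funext i; simp [Code.coord, outQuant]
  have key := abs_bitValue_truncBits_sub_le mo (t := (f (gridPoint u) j - lo j) / width j)
    (div_nonneg (by linarith) hw0.le) ((div_le_one hw0).2 (by linarith))
  have e : (outDecode lo width (outQuant lo width mo (f (gridPoint u))) - f (gridPoint u)) j
      = width j * (bitValue (truncBits mo ((f (gridPoint u) j - lo j) / width j))
        - (f (gridPoint u) j - lo j) / width j) := by
    simp only [Pi.sub_apply, outDecode, hc]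
    field_simp
    ring
  rw [e, Real.norm_eq_abs, abs_mul, abs_of_pos hw0]
  exact (mul_le_of_le_one_left (abs_nonneg _) hw1).trans key

/-! ### Efficient Turing computability -/

/-- The machine's input: the bits of the code, followed by `mo` in unary (the mark is `none`). -/
def inputWord {d n : ℕ} (u : Code d n) (mo : ℕ) : List (Option Bool) :=
  (List.ofFn u).map some ++ List.replicate mo none

/-- One deterministic Turing machine computes all maps `F n mo`, within `p (n + mo)` steps for a
polynomial `p`. -/
def PolyTimeComputable {d m : ℕ} (F : (n mo : ℕ) → Code d n → Code m mo) : Prop :=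
  ∃ (M : Turing.TM2ComputableAux (Option Bool) Bool) (p : Polynomial ℕ),
    ∀ (n mo : ℕ) (u : Code d n),
      Nonempty (Turing.TM2OutputsInTime M.tm
        ((inputWord u mo).map M.inputAlphabet.symm)
        (some ((List.ofFn (F n mo u)).map M.outputAlphabet.symm))
        (p.eval (n + mo)))

/-! ### Sequential evaluation -/

/-- Start from the values `x` of `N` nodes and append `s` further values one by one, the `t`-th
being `step t` applied to all `N + t` values present so far. -/
def unroll {α : Type} {N : ℕ} (x : Fin N → α) :
    (s : ℕ) → ((t : Fin s) → (Fin (N + t) → α) → α) → Fin (N + s) → α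
  | 0, _ => x
  | s + 1, step =>
    Fin.snoc (α := fun _ => α) (unroll x s fun t => step t.castSucc)
      (step (Fin.last s) (unroll x s fun t => step t.castSucc))

/-- The last `K` entries of a sequence of length `N + s`, where `K ≤ s`. -/
def lastEntries {α : Type} {N s : ℕ} (K : ℕ) (hK : K ≤ s) (z : Fin (N + s) → α) : Fin K → α :=
  fun i => z ⟨N + (s - K) + i, by omega⟩

/-! ### Computation DAGs of bounded local arity -/

/-- A Boolean gate of fan-in at most `3`, with parents among `j` earlier nodes. -/
structure Gate (j : ℕ) where
  parents : Finset (Fin j)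
  card_parents_le : parents.card ≤ 3
  op : (parents → Bool) → Bool

/-- A computation DAG with `N` input nodes and `size` internal nodes, listed in a topological
order; the last `K` internal nodes are the outputs. -/
structure DAG (N K : ℕ) where
  size : ℕ
  le_size : K ≤ size
  gate : (t : Fin size) → Gate (N + t)

namespace DAG

variable {N K : ℕ}

/-- The sequence of all node values: the input bits, then the gate values in topological order. -/
def trace (C : DAG N K) (x : Fin N → Bool) : Fin (N + C.size) → Bool :=
  unroll x C.size fun t z => (C.gate t).op fun i => z i

/-- The map computed by the DAG. -/
def eval (C : DAG N K) (x : Fin N → Bool) : Fin K → Bool :=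
  lastEntries K C.le_size (C.trace x)

/-- The length of a longest directed path. -/
def depth (C : DAG N K) : ℕ :=
  Finset.univ.sup
    (unroll (fun _ : Fin N => 0) C.size fun t l => (C.gate t).parents.sup l + 1)

end DAG

/-! ### Linear autoregressive next-token predictors -/

/-- A linear predictor (linear threshold unit) of the next bit from a prefix of `j` bits. -/
structure LinearPredictor (j : ℕ) where
  weight : Fin j → ℝ
  threshold : ℝ

open Classical in
/-- The predicted bit is `1` iff `∑ i, weight i * z i ≥ threshold`. -/
def LinearPredictor.predict {j : ℕ} (h : LinearPredictor j) (z : Fin j → Bool) : Bool :=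
  decide (h.threshold ≤ ∑ i, if z i then h.weight i else 0)

/-- A linear autoregressive predictor for prompts of length `N` and `s` generated tokens: for each
position, a linear next-token predictor that reads the whole prefix. -/
abbrev ARPredictor (N s : ℕ) : Type := (t : Fin s) → LinearPredictor (N + t)

namespace ARPredictor

variable {N s : ℕ}

/-- At each position at most `3` weights are nonzero. -/
def Sparse (h : ARPredictor N s) : Prop :=
  ∀ t, {i | (h t).weight i ≠ 0}.ncard ≤ 3

/-- Zero training error: on every prefix of every training sequence the next token is predicted
correctly. -/
def Fits (h : ARPredictor N s) {M : ℕ} (S : Fin M → Fin (N + s) → Bool) : Prop :=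
  ∀ (i : Fin M) (t : Fin s),
    (h t).predict (fun j => S i ⟨j, by omega⟩) = S i ⟨N + t, by omega⟩

/-- Autoregressive generation: the prompt, followed by `s` tokens, each predicted from all tokens
before it. -/
def generate (h : ARPredictor N s) (x : Fin N → Bool) : Fin (N + s) → Bool :=
  unroll x s fun t z => (h t).predict z

/-- The answer to a prompt: the last `K` generated tokens. -/
def answer (h : ARPredictor N s) (K : ℕ) (hK : K ≤ s) (x : Fin N → Bool) : Fin K → Bool :=
  lastEntries K hK (h.generate x)

end ARPredictor

/-! ### Training algorithms and training time

A random access machine over the integers with unit-cost instructions. There is no multiplication,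
so that after `T` steps on Boolean data all numbers have `O(T)` bits. -/

/-- Registers, and arrays: `mem k a` is entry `a` of array `k`. -/
structure RamState where
  reg : ℕ → ℤ
  mem : ℕ → ℕ → ℤ

/-- Programs. Register and array numbers are fixed in the program text, positions in an array are
read from registers. -/
inductive RamProgram : Type
  /-- `reg r := c` -/
  | const (r : ℕ) (c : ℤ)
  /-- `reg r := reg a + reg b` -/
  | add (r a b : ℕ)
  /-- `reg r := reg a - reg b` -/
  | sub (r a b : ℕ)
  /-- `reg r := mem k (reg a)` -/
  | load (r k a : ℕ)
  /-- `mem k (reg a) := reg r` -/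
  | store (k a r : ℕ)
  /-- `p; q` -/
  | seq (p q : RamProgram)
  /-- `if reg a > 0 then p else q` -/
  | ite (a : ℕ) (p q : RamProgram)
  /-- repeat `p` as often as `reg a` says on entry -/
  | loop (a : ℕ) (p : RamProgram)

/-- The final state and the number of steps. -/
def RamProgram.exec : RamProgram → RamState → RamState × ℕ
  | .const r c, st => ({ st with reg := Function.update st.reg r c }, 1)
  | .add r a b, st => ({ st with reg := Function.update st.reg r (st.reg a + st.reg b) }, 1)
  | .sub r a b, st => ({ st with reg := Function.update st.reg r (st.reg a - st.reg b) }, 1)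
  | .load r k a, st => ({ st with reg := Function.update st.reg r (st.mem k (st.reg a).toNat) }, 1)
  | .store k a r, st =>
    (⟨st.reg, Function.update st.mem k
      (Function.update (st.mem k) (st.reg a).toNat (st.reg r))⟩, 1)
  | .seq p q, st =>
    ((q.exec (p.exec st).1).1, (p.exec st).2 + (q.exec (p.exec st).1).2)
  | .ite a p q, st =>
    if 0 < st.reg a then ((p.exec st).1, (p.exec st).2 + 1) else ((q.exec st).1, (q.exec st).2 + 1)
  | .loop a p, st =>
    (fun c : RamState × ℕ => ((p.exec c.1).1, c.2 + (p.exec c.1).2 + 1))^[(st.reg a).toNat] (st, 1)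

/-- The start state of training on `M` sequences of length `N + s`: the numbers `M`, `N`, `s` in
registers `0`, `1`, `2`, and token `j` of sequence `i` in array `0` at position
`finProdFinEquiv (i, j) = i * (N + s) + j`; everything else is `0`. -/
def trainInput {N s M : ℕ} (S : Fin M → Fin (N + s) → Bool) : RamState where
  reg r := if r = 0 then M else if r = 1 then N else if r = 2 then s else 0
  mem k a :=
    if h : k = 0 ∧ a < M * (N + s) then
      if S (finProdFinEquiv.symm ⟨a, h.2⟩).1 (finProdFinEquiv.symm ⟨a, h.2⟩).2 then 1 else 0
    else 0

/-- The predictor output by training: row `t` of array `1` (rows have length `N + s + 1`) holds the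
weights of the predictor at position `t`, and in its last entry the threshold. -/
def trained (A : RamProgram) {N s M : ℕ} (S : Fin M → Fin (N + s) → Bool) : ARPredictor N s :=
  fun t =>
    { weight := fun j => ((A.exec (trainInput S)).1.mem 1 (t * (N + s + 1) + j) : ℝ)
      threshold := ((A.exec (trainInput S)).1.mem 1 (t * (N + s + 1) + (N + s)) : ℝ) }

/-- The number of steps of training. -/
def trainTime (A : RamProgram) {N s M : ℕ} (S : Fin M → Fin (N + s) → Bool) : ℕ :=
  (A.exec (trainInput S)).2

/-! ### Neural networks -/

/-- A feedforward ReLU network with `N` inputs, `hidden` hidden units and `m` real outputs. Units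
are listed in a topological order; absent connections have weight `0`. -/
structure ReluNet (N m : ℕ) where
  hidden : ℕ
  weight : (t : Fin hidden) → Fin (N + t) → ℝ
  bias : Fin hidden → ℝ
  outWeight : Fin m → Fin (N + hidden) → ℝ
  outBias : Fin m → ℝ

namespace ReluNet

variable {N m : ℕ}

/-- The map computed by the network. -/
def eval (Φ : ReluNet N m) (x : Fin N → ℝ) : Fin m → ℝ :=
  fun k => Φ.outBias k + ∑ i, Φ.outWeight k i *
    unroll x Φ.hidden (fun t z => max 0 (Φ.bias t + ∑ j, Φ.weight t j * z j)) i

/-- The number of units (hidden and output) and connections. -/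
def size (Φ : ReluNet N m) : ℕ :=
  Φ.hidden + m + (∑ t, {j | Φ.weight t j ≠ 0}.ncard) + ∑ k, {i | Φ.outWeight k i ≠ 0}.ncard

open Classical in
/-- The length of a longest path of connections between units, the output layer included. -/
def depth (Φ : ReluNet N m) : ℕ :=
  Finset.univ.sup
    (unroll (fun _ : Fin N => 0) Φ.hidden
      fun t l => (Finset.univ.filter fun j => Φ.weight t j ≠ 0).sup l + 1) + 1

end ReluNet

/-- Bits as real numbers. -/
def bitsToReal {N : ℕ} (u : Fin N → Bool) : Fin N → ℝ := fun i => if u i then 1 else 0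

end

end ARLearn

open ARLearn

/-!
Why the theorem is true.

**The circuit.** All circuits are built of NOR gates with at most two parents (a gate without parents
is the constant `true`). A configuration of a multi-stack machine, written in one-hot bits with stack
cells numbered from the top, evolves locally: a bit after one step depends on boundedly many bits
before it (`exists_stepAux_local`). A Boolean function of boundedly many available functions costs
boundedly many gates (`exists_reach_of_determined`), so `T` steps cost a polynomial number of gates;
only the cells in the backward light cone of the output are needed, and no bound on the stack heights
enters (`PolyTimeComputable.exists_norCircuit`). Constant gates are added so that there are at least as
many gates as inputs, which makes all later bounds polynomial in the number of gates alone.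

**The dataset.** A `3`-sparse linear predictor is a Boolean function of three tokens
(`LinearPredictor.exists_eq_look`), so at each position there are only polynomially many. For each of
them that errs on some trace of the DAG, one such trace is put into a set, the teaching set; the
distribution is uniform on it. Polynomially many samples contain the whole teaching set with
probability at least `1 - δ` (`le_measure_forall_exists_eq`, the coupon collector bound), and then a
sparse predictor without training error is right at every position of every trace, so that it
generates the traces (`ARPredictor.generate_eq_trace`).

**Training.** A NOR gate is a linear threshold function with weights `-1` and threshold `0`, hence
exhaustive search for a pair of parents, position by position, finds a predictor that fits all
samples (`trained_norTrainer`).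

**The network.** On bits a NOR gate is the ReLU unit `max 0 (1 - ∑ parents)`, and decoding binary
numbers is linear (`NorCircuit.eval_reluNet`).
-/

namespace ARLearn

/-! ### Sequential evaluation -/

section Unroll

variable {α : Type} {N : ℕ}

theorem unroll_of_lt (x : Fin N → α) (s : ℕ) (step : (t : Fin s) → (Fin (N + t) → α) → α)
    (i : Fin N) : unroll x s step ⟨i, by omega⟩ = x i := by
  induction s with
  | zero => rfl
  | succ s ih =>
    have e : (⟨i, by omega⟩ : Fin (N + (s + 1))) = Fin.castSucc (n := N + s) ⟨i, by omega⟩ := rfl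
    rw [e, unroll]
    exact (Fin.snoc_castSucc (α := fun _ => α) _ _ _).trans (ih _)

theorem unroll_add (x : Fin N → α) (s : ℕ) (step : (t : Fin s) → (Fin (N + t) → α) → α)
    (t : Fin s) :
    unroll x s step ⟨N + t, by omega⟩ = step t fun j => unroll x s step ⟨j, by omega⟩ := by
  induction s with
  | zero => exact t.elim0
  | succ s ih =>
    have cast (j : ℕ) (hj : j < N + s) : unroll x (s + 1) step ⟨j, by omega⟩
        = unroll x s (fun t => step t.castSucc) ⟨j, hj⟩ :=
      Fin.snoc_castSucc (α := fun _ => α) _ _ (⟨j, hj⟩ : Fin (N + s))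
    obtain ⟨t, ht⟩ := t
    rcases Nat.lt_succ_iff_lt_or_eq.1 ht with h | rfl
    · refine (cast (N + t) (by omega)).trans ((ih _ ⟨t, h⟩).trans ?_)
      exact congrArg (step ⟨t, ht⟩) (funext fun j => (cast j (by omega)).symm)
    · refine (Fin.snoc_last (α := fun _ => α) (n := N + t) _ _).trans ?_
      exact congrArg (step ⟨t, ht⟩) (funext fun j => (cast j (by omega)).symm)

/-- `unroll` is the only sequence that starts with `x` and obeys the recursion. -/
theorem unroll_eq {x : Fin N → α} {s : ℕ} {step : (t : Fin s) → (Fin (N + t) → α) → α}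
    {z : Fin (N + s) → α} (h0 : ∀ i : Fin N, z ⟨i, by omega⟩ = x i)
    (h1 : ∀ t : Fin s, z ⟨N + t, by omega⟩ = step t fun j => z ⟨j, by omega⟩) :
    unroll x s step = z := by
  have key : ∀ i (hi : i < N + s), unroll x s step ⟨i, hi⟩ = z ⟨i, hi⟩ := by
    intro i
    induction i using Nat.strong_induction_on with
    | _ i ih =>
      intro hi
      by_cases h : i < N
      · exact (unroll_of_lt x s step ⟨i, h⟩).trans (h0 ⟨i, h⟩).symm
      · obtain ⟨t, rfl⟩ := Nat.exists_eq_add_of_le (not_lt.1 h)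
        refine (unroll_add x s step ⟨t, by omega⟩).trans (Eq.trans ?_ (h1 ⟨t, by omega⟩).symm)
        exact congrArg _ (funext fun j => ih j j.2 (by omega))
  exact funext fun i => key i i.2

/-- In a recursion `l t = sup (some earlier values) + 1` started at `0`, the values are at most the
number of steps. -/
theorem unroll_sup_le (s : ℕ) (parents : (t : Fin s) → Finset (Fin (N + t))) :
    Finset.univ.sup (unroll (fun _ : Fin N => 0) s fun t l => (parents t).sup l + 1) ≤ s := by
  have key : ∀ i (hi : i < N + s), unroll (fun _ : Fin N => 0) s
      (fun t l => (parents t).sup l + 1) ⟨i, hi⟩ ≤ i + 1 - N := by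
    intro i
    induction i using Nat.strong_induction_on with
    | _ i ih =>
      intro hi
      by_cases h : i < N
      · exact (unroll_of_lt (fun _ : Fin N => 0) s _ ⟨i, h⟩).trans_le (Nat.zero_le _)
      · obtain ⟨t, rfl⟩ := Nat.exists_eq_add_of_le (not_lt.1 h)
        refine (unroll_add (fun _ : Fin N => 0) s _ ⟨t, by omega⟩).trans_le ?_
        have : (parents ⟨t, by omega⟩).sup (fun j => unroll (fun _ : Fin N => 0) s
            (fun t l => (parents t).sup l + 1) ⟨j, by omega⟩) ≤ t :=
          Finset.sup_le fun j _ => (ih j j.2 (by omega)).trans (by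
            have : (j : ℕ) < N + t := j.2
            omega)
        simp only at this ⊢
        omega
  exact Finset.sup_le fun i _ => (key i i.2).trans (by omega)

end Unroll

/-! ### Chains of NOR gates -/

section Chain

variable {X : Type}

/-- The function `f` is the constant `true` (a NOR gate without parents) or a NOR of two functions
of `A`. -/
def Derivable (A : Set (X → Bool)) (f : X → Bool) : Prop :=
  (f = fun _ => true) ∨ ∃ a ∈ A, ∃ b ∈ A, f = fun x => !(a x || b x)

/-- A list of functions, each derivable from `A` and the functions before it. This is a NOR circuit
in which every gate is identified with the function of the inputs that it computes. -/
def IsChain : Set (X → Bool) → List (X → Bool) → Prop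
  | _, [] => True
  | A, f :: L => Derivable A f ∧ IsChain (insert f A) L

/-- At most `k` NOR gates suffice to compute all functions of `B` from those of `A`. -/
def Reach (k : ℕ) (A B : Set (X → Bool)) : Prop :=
  ∃ L, IsChain A L ∧ L.length ≤ k ∧ B ⊆ A ∪ {g | g ∈ L}

theorem Derivable.mono {A A' : Set (X → Bool)} (h : A ⊆ A') {f : X → Bool} (hf : Derivable A f) :
    Derivable A' f := by
  rcases hf with rfl | ⟨a, ha, b, hb, rfl⟩
  exacts [Or.inl rfl, Or.inr ⟨a, h ha, b, h hb, rfl⟩]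

theorem IsChain.mono {L : List (X → Bool)} : ∀ {A A' : Set (X → Bool)}, A ⊆ A' → IsChain A L →
    IsChain A' L := by
  induction L with
  | nil => intros; trivial
  | cons f L ih => exact fun h hL => ⟨hL.1.mono h, ih (Set.insert_subset_insert h) hL.2⟩

theorem IsChain.append {L L' : List (X → Bool)} : ∀ {A : Set (X → Bool)}, IsChain A L →
    IsChain (A ∪ {g | g ∈ L}) L' → IsChain A (L ++ L') := by
  induction L with
  | nil => intro A _ h; simpa using h
  | cons f L ih =>
    intro A h h'
    refine ⟨h.1, ih h.2 (h'.mono ?_)⟩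
    intro g hg
    simp only [Set.mem_union, Set.mem_ofPred_eq, List.mem_cons, Set.mem_insert_iff] at hg ⊢
    tauto

theorem isChain_of_forall {L : List (X → Bool)} : ∀ {A : Set (X → Bool)},
    (∀ f ∈ L, Derivable A f) → IsChain A L := by
  induction L with
  | nil => intros; trivial
  | cons f L ih =>
    intro A h
    exact ⟨h f (by simp), ih fun g hg => (h g (by simp [hg])).mono (Set.subset_insert _ _)⟩

theorem IsChain.derivable_getElem {L : List (X → Bool)} : ∀ {A : Set (X → Bool)}, IsChain A L →
    ∀ t (ht : t < L.length), Derivable (A ∪ {g | ∃ j, ∃ h : j < t, g = L[j]}) L[t] := by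
  induction L with
  | nil => intro A _ t ht; simp at ht
  | cons f L ih =>
    intro A h t ht
    cases t with
    | zero => exact h.1.mono Set.subset_union_left
    | succ t =>
      refine (ih h.2 t (by simpa using ht)).mono ?_
      rintro g (hg | ⟨j, hj, rfl⟩)
      · rcases hg with rfl | hg
        · exact Or.inr ⟨0, by omega, rfl⟩
        · exact Or.inl hg
      · exact Or.inr ⟨j + 1, by omega, rfl⟩

theorem Reach.refl (A : Set (X → Bool)) {B : Set (X → Bool)} (h : B ⊆ A) : Reach 0 A B :=
  ⟨[], trivial, le_rfl, h.trans Set.subset_union_left⟩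

theorem Reach.mono {k k' : ℕ} {A A' B B' : Set (X → Bool)} (h : Reach k A B) (hk : k ≤ k')
    (hA : A ⊆ A') (hB : B' ⊆ B) : Reach k' A' B' := by
  obtain ⟨L, h1, h2, h3⟩ := h
  exact ⟨L, h1.mono hA, h2.trans hk, hB.trans (h3.trans (Set.union_subset_union_left _ hA))⟩

theorem Reach.trans {k l : ℕ} {A B C : Set (X → Bool)} (h : Reach k A B) (h' : Reach l B C) :
    Reach (k + l) A C := by
  obtain ⟨L, h1, h2, h3⟩ := h
  obtain ⟨L', h1', h2', h3'⟩ := h'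
  refine ⟨L ++ L', h1.append (h1'.mono h3), by simp; omega, ?_⟩
  intro g hg
  rcases h3' hg with hg | hg
  · rcases h3 hg with hg | hg
    · exact Or.inl hg
    · exact Or.inr (by simp only [Set.mem_ofPred_eq, List.mem_append] at hg ⊢; tauto)
  · exact Or.inr (by simp only [Set.mem_ofPred_eq, List.mem_append] at hg ⊢; tauto)

theorem Reach.union {k l : ℕ} {A B C : Set (X → Bool)} (h : Reach k A B) (h' : Reach l A C) :
    Reach (k + l) A (B ∪ C) := by
  obtain ⟨L, h1, h2, h3⟩ := h
  obtain ⟨L', h1', h2', h3'⟩ := h'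
  refine ⟨L ++ L', h1.append (h1'.mono Set.subset_union_left), by simp; omega, ?_⟩
  rintro g (hg | hg)
  · rcases h3 hg with hg | hg
    · exact Or.inl hg
    · exact Or.inr (by simp only [Set.mem_ofPred_eq, List.mem_append] at hg ⊢; tauto)
  · rcases h3' hg with hg | hg
    · exact Or.inl hg
    · exact Or.inr (by simp only [Set.mem_ofPred_eq, List.mem_append] at hg ⊢; tauto)

theorem Reach.image {k : ℕ} {A : Set (X → Bool)} {ι : Type} (I : Finset ι) (f : ι → X → Bool)
    (h : ∀ i ∈ I, Reach k A {f i}) : Reach (I.card * k) A (f '' I) := by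
  classical
  induction I using Finset.induction_on with
  | empty => exact (Reach.refl A (by simp)).mono (by simp) le_rfl le_rfl
  | insert i I hi ih =>
    refine ((h i (by simp)).union (ih fun j hj => h j (by simp [hj]))).mono ?_ le_rfl ?_
    · rw [Finset.card_insert_of_notMem hi]; linarith
    · simp [Set.image_insert_eq]

theorem Derivable.reach {A : Set (X → Bool)} {f : X → Bool} (h : Derivable A f) :
    Reach 1 A {f} :=
  ⟨[f], ⟨h, trivial⟩, le_rfl, by simp⟩

theorem Reach.nor {k l : ℕ} {A : Set (X → Bool)} {a b : X → Bool} (ha : Reach k A {a})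
    (hb : Reach l A {b}) : Reach (k + l + 1) A {fun x => !(a x || b x)} :=
  (ha.union hb).trans (Derivable.reach (Or.inr ⟨a, by simp, b, by simp, rfl⟩))

theorem reach_const (A : Set (X → Bool)) (v : Bool) : Reach 3 A {fun _ => v} := by
  have h : Reach 1 A {fun _ => true} := Derivable.reach (Or.inl rfl)
  cases v
  · simpa using h.nor h
  · exact h.mono (by omega) le_rfl le_rfl

/-- A Boolean function of boundedly many functions of `A` costs boundedly many gates, by expansion
along its first argument. -/
theorem exists_reach_comp (B : ℕ) : ∃ C : ℕ, ∀ (X : Type) (A : Set (X → Bool))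
    (f : Fin B → X → Bool), (∀ i, f i ∈ A) → ∀ G : (Fin B → Bool) → Bool,
    Reach C A {fun x => G fun i => f i x} := by
  induction B with
  | zero =>
    refine ⟨3, fun X A f _ G => ?_⟩
    have : (fun x => G fun i => f i x) = fun _ => G Fin.elim0 :=
      funext fun x => congrArg G (funext fun i => i.elim0)
    rw [this]
    exact reach_const A _
  | succ B ih =>
    obtain ⟨C, hC⟩ := ih
    refine ⟨8 * C + 13, fun X A f hf G => ?_⟩
    have hs : Reach 0 A {f 0} := Reach.refl A (by simpa using hf 0)
    have h0 := hC X A (fun i => f i.succ) (fun i => hf _) fun w => G (Fin.cons false w)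
    have h1 := hC X A (fun i => f i.succ) (fun i => hf _) fun w => G (Fin.cons true w)
    have h01 := ((hs.nor hs).nor (h1.nor h1)).nor (hs.nor (h0.nor h0))
    refine (h01.nor h01).mono (by omega) le_rfl (le_of_eq ?_)
    congr 1
    funext x
    have e : (fun i => f i x) = Fin.cons (f 0 x) fun i => f (Fin.succ i) x := by
      funext i; refine Fin.cases ?_ (fun j => ?_) i <;> simp
    rw [e]
    cases f 0 x <;> simp

/-- A function that is determined by a family of functions of `A`, indexed by a fixed finite type,
costs boundedly many gates. -/
theorem exists_reach_of_determined (ι : Type) [Finite ι] : ∃ C : ℕ, ∀ (X : Type)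
    (A : Set (X → Bool)) (f : ι → X → Bool), (∀ i, f i ∈ A) → ∀ g : X → Bool,
    (∀ x y, (∀ i, f i x = f i y) → g x = g y) → Reach C A {g} := by
  classical
  obtain ⟨n, ⟨e⟩⟩ := Finite.exists_equiv_fin ι
  obtain ⟨C, hC⟩ := exists_reach_comp n
  refine ⟨C, fun X A f hf g hg => ?_⟩
  have hfac : Function.FactorsThrough g fun x i => f (e.symm i) x := by
    intro x y hxy
    refine hg x y fun i => ?_
    simpa using congrFun hxy (e i)
  have := hC X A (fun i => f (e.symm i)) (fun i => hf _)
    (Function.extend (fun x i => f (e.symm i) x) g fun _ => false)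
  simp only [hfac.extend_apply] at this
  exact this

end Chain

/-! ### NOR circuits -/

/-- A circuit with `N` inputs whose gates are NORs of at most two parents (without parents: the
constant `true`); the last `K` gates are the outputs. -/
structure NorCircuit (N K : ℕ) where
  size : ℕ
  le_size : K ≤ size
  parents : (t : Fin size) → Finset (Fin (N + t))
  card_parents_le : ∀ t, (parents t).card ≤ 2

namespace NorCircuit

variable {N K : ℕ}

/-- The computation DAG of a NOR circuit. -/
def toDAG (C : NorCircuit N K) : DAG N K where
  size := C.size
  le_size := C.le_size
  gate t :=
    { parents := C.parents t
      card_parents_le := (C.card_parents_le t).trans (by omega)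
      op := fun v => decide (∀ i, v i = false) }

theorem depth_toDAG_le (C : NorCircuit N K) : C.toDAG.depth ≤ C.size :=
  unroll_sup_le C.size C.parents

/-- The trace of the DAG, with its length expressed by the size of the circuit. -/
def values (C : NorCircuit N K) (u : Fin N → Bool) : Fin (N + C.size) → Bool :=
  C.toDAG.trace u

theorem values_of_lt (C : NorCircuit N K) (u : Fin N → Bool) (i : Fin N) :
    C.values u ⟨i, by omega⟩ = u i :=
  unroll_of_lt u C.size _ i

theorem values_add (C : NorCircuit N K) (u : Fin N → Bool) (t : Fin C.size) :
    C.values u ⟨N + t, by omega⟩ = true ↔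
      ∀ i ∈ C.parents t, C.values u ⟨i, by omega⟩ = false := by
  have h : C.values u ⟨N + t, by omega⟩
      = decide (∀ i : C.parents t, C.values u ⟨i.1, by omega⟩ = false) :=
    unroll_add u C.size (fun t z => (C.toDAG.gate t).op fun i => z i) t
  rw [h]
  simp

end NorCircuit

/-- A chain that starts from the input bits and computes all output bits gives a circuit. At the end
the outputs are recomputed in order by double negation, and constant gates are added so that the
number of gates is at least the number of inputs. -/
theorem exists_norCircuit {N K k : ℕ} {o : Fin K → (Fin N → Bool) → Bool}
    (h : Reach k (Set.range fun (i : Fin N) (u : Fin N → Bool) => u i) (Set.range o)) :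
    ∃ C : NorCircuit N K, C.size ≤ k + N + 2 * K ∧ N ≤ C.size ∧
      C.toDAG.eval = fun u i => o i u := by
  classical
  obtain ⟨L, hL, hlen, hsub⟩ := h
  set A : Set ((Fin N → Bool) → Bool) := Set.range fun (i : Fin N) (u : Fin N → Bool) => u i
  let no : Fin K → (Fin N → Bool) → Bool := fun i u => !(o i u || o i u)
  let L1 := L ++ List.replicate N (fun _ => true)
  have hL1 : IsChain A L1 := hL.append (isChain_of_forall fun f hf =>
    Or.inl (List.eq_of_mem_replicate hf))
  let L2 := L1 ++ List.ofFn no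
  have hL2 : IsChain A L2 := by
    refine hL1.append (isChain_of_forall fun f hf => ?_)
    obtain ⟨i, rfl⟩ := List.mem_ofFn.1 hf
    have : o i ∈ A ∪ {g | g ∈ L1} := by
      rcases hsub ⟨i, rfl⟩ with h | h
      · exact Or.inl h
      · exact Or.inr (by simp only [Set.mem_ofPred_eq] at h; simp [L1, h])
    exact Or.inr ⟨_, this, _, this, rfl⟩
  let L3 := L2 ++ List.ofFn o
  have hL3 : IsChain A L3 := by
    refine hL2.append (isChain_of_forall fun f hf => ?_)
    obtain ⟨i, rfl⟩ := List.mem_ofFn.1 hf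
    have : no i ∈ A ∪ {g | g ∈ L2} := Or.inr (by simp [L2, List.mem_ofFn])
    exact Or.inr ⟨_, this, _, this, by funext u; simp [no]⟩
  have hlen3 : L3.length = L.length + N + K + K := by simp [L3, L2, L1]; omega
  let val : ℕ → (Fin N → Bool) → Bool := fun i u =>
    if h : i < N then u ⟨i, h⟩ else (L3[i - N]?.getD fun _ => false) u
  have valA : ∀ t (ht : t < L3.length), val (N + t) = L3[t] := by
    intro t ht; funext u; simp [val, ht]
  have mem : ∀ t, ∀ a ∈ A ∪ {g | ∃ j, ∃ _ : j < t, ∃ h : j < L3.length, g = L3[j]},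
      ∃ i : Fin (N + t), val i = a := by
    rintro t a (⟨i, rfl⟩ | ⟨j, hj, hj', rfl⟩)
    · exact ⟨⟨i, by omega⟩, by funext u; simp [val]⟩
    · exact ⟨⟨N + j, by omega⟩, valA j hj'⟩
  have hpar : ∀ t : Fin L3.length, ∃ P : Finset (Fin (N + t)), P.card ≤ 2 ∧
      ∀ u, val (N + t) u = decide (∀ i ∈ P, val i u = false) := by
    intro t
    have hd := (hL3.derivable_getElem t t.2).mono
      (A' := A ∪ {g | ∃ j, ∃ _ : j < (t : ℕ), ∃ h : j < L3.length, g = L3[j]})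
      (by
        refine Set.union_subset_union_right _ ?_
        rintro g ⟨j, hj, rfl⟩
        exact ⟨j, hj, by omega, rfl⟩)
    rw [valA t t.2]
    rcases hd with h | ⟨a, ha, b, hb, h⟩
    · exact ⟨∅, by simp, fun u => by rw [h]; simp⟩
    · obtain ⟨i, rfl⟩ := mem t a ha
      obtain ⟨j, rfl⟩ := mem t b hb
      refine ⟨{i, j}, Finset.card_le_two, fun u => ?_⟩
      rw [h]
      cases h1 : val i u <;> cases h2 : val j u <;> simp [h1, h2]
  choose P hP hval using hpar
  let C : NorCircuit N K := ⟨L3.length, by omega, P, hP⟩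
  have htr : ∀ u, C.toDAG.trace u = fun i : Fin (N + C.toDAG.size) => val i u := by
    intro u
    refine unroll_eq (fun i => by simp [val]) fun t => ?_
    exact (hval t u).trans (by simp [C, NorCircuit.toDAG])
  refine ⟨C, by simp only [C]; omega, by simp only [C]; omega, ?_⟩
  funext u i
  unfold DAG.eval lastEntries
  rw [htr]
  have e : N + (C.toDAG.size - K) + i = N + (L2.length + i) := by
    have : C.toDAG.size = L2.length + K := by simp [C, NorCircuit.toDAG, L3]
    omega
  have hi : L2.length + i < L3.length := by simp [L3]
  have e3 : L3[L2.length + (i : ℕ)] = o i := by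
    simp [L3]
  rw [← e3, ← valA _ hi]
  exact congrArg (fun j => val j u) e

/-! ### Circuits for multi-stack Turing machines -/

section Machine

open Turing

theorem Reach.range {X : Type} {k : ℕ} {A : Set (X → Bool)} {ι : Type} [Finite ι]
    {f : ι → X → Bool} (h : ∀ i, Reach k A {f i}) : Reach (Nat.card ι * k) A (Set.range f) := by
  have := Fintype.ofFinite ι
  refine (Reach.image Finset.univ f fun i _ => h i).mono ?_ le_rfl ?_
  · simp [Nat.card_eq_fintype_card]
  · simp

variable {K Λ σ : Type} {Γ : K → Type} [DecidableEq K]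

/-- Executing a statement is a local operation if stacks are read from the top: the new label and
state depend on the state and on the top `c` cells of each stack, and a cell of the new stack depends
in addition on the old cells at distance at most `c`. -/
theorem exists_stepAux_local (q : TM2.Stmt Γ Λ σ) : ∃ c : ℕ, ∀ (v : σ) (S S' : ∀ k, List (Γ k)),
    (∀ k j, j < c → (S k)[j]? = (S' k)[j]?) →
    (TM2.stepAux q v S).l = (TM2.stepAux q v S').l ∧
    (TM2.stepAux q v S).var = (TM2.stepAux q v S').var ∧
    ∀ k i, (∀ j, i ≤ j + c → j ≤ i + c → (S k)[j]? = (S' k)[j]?) →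
      ((TM2.stepAux q v S).stk k)[i]? = ((TM2.stepAux q v S').stk k)[i]? := by
  induction q with
  | push k₀ f q ih =>
    obtain ⟨c, hc⟩ := ih
    refine ⟨c + 1, fun v S S' h => ?_⟩
    have h' : ∀ k j, (∀ j', j ≤ j' + 1 → j' ≤ j → (S k)[j']? = (S' k)[j']?) →
        (Function.update S k₀ (f v :: S k₀) k)[j]?
          = (Function.update S' k₀ (f v :: S' k₀) k)[j]? := by
      intro k j hj
      by_cases hk : k = k₀
      · subst hk
        cases j with
        | zero => simp
        | succ j => simpa using hj j le_rfl (Nat.le_succ j)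
      · simpa [hk] using hj j (Nat.le_succ j) le_rfl
    obtain ⟨h1, h2, h3⟩ := hc v _ _ fun k j hj => h' k j fun j' _ _ => h k j' (by omega)
    exact ⟨h1, h2, fun k i hi => h3 k i fun j _ _ => h' k j fun j' _ _ =>
      hi j' (by omega) (by omega)⟩
  | peek k₀ f q ih =>
    obtain ⟨c, hc⟩ := ih
    refine ⟨c + 1, fun v S S' h => ?_⟩
    have e : (S k₀).head? = (S' k₀).head? := by
      simpa [List.head?_eq_getElem?] using h k₀ 0 (by omega)
    simp only [TM2.stepAux, e]
    obtain ⟨h1, h2, h3⟩ := hc (f v (S' k₀).head?) S S' fun k j hj => h k j (by omega)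
    exact ⟨h1, h2, fun k i hi => h3 k i fun j _ _ => hi j (by omega) (by omega)⟩
  | pop k₀ f q ih =>
    obtain ⟨c, hc⟩ := ih
    refine ⟨c + 1, fun v S S' h => ?_⟩
    have e : (S k₀).head? = (S' k₀).head? := by
      simpa [List.head?_eq_getElem?] using h k₀ 0 (by omega)
    have h' : ∀ k j, (∀ j', j ≤ j' → j' ≤ j + 1 → (S k)[j']? = (S' k)[j']?) →
        (Function.update S k₀ (S k₀).tail k)[j]?
          = (Function.update S' k₀ (S' k₀).tail k)[j]? := by
      intro k j hj
      by_cases hk : k = k₀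
      · subst hk
        simpa using hj (j + 1) (Nat.le_succ j) le_rfl
      · simpa [hk] using hj j le_rfl (Nat.le_succ j)
    simp only [TM2.stepAux, e]
    obtain ⟨h1, h2, h3⟩ := hc (f v (S' k₀).head?) _ _ fun k j hj => h' k j fun j' _ _ =>
      h k j' (by omega)
    exact ⟨h1, h2, fun k i hi => h3 k i fun j _ _ => h' k j fun j' _ _ =>
      hi j' (by omega) (by omega)⟩
  | load f q ih =>
    obtain ⟨c, hc⟩ := ih
    exact ⟨c, fun v S S' h => hc (f v) S S' h⟩
  | branch f q₁ q₂ ih₁ ih₂ =>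
    obtain ⟨c₁, hc₁⟩ := ih₁
    obtain ⟨c₂, hc₂⟩ := ih₂
    refine ⟨c₁ + c₂, fun v S S' h => ?_⟩
    simp only [TM2.stepAux]
    cases f v with
    | true =>
      obtain ⟨h1, h2, h3⟩ := hc₁ v S S' fun k j hj => h k j (by omega)
      exact ⟨h1, h2, fun k i hi => h3 k i fun j _ _ => hi j (by omega) (by omega)⟩
    | false =>
      obtain ⟨h1, h2, h3⟩ := hc₂ v S S' fun k j hj => h k j (by omega)
      exact ⟨h1, h2, fun k i hi => h3 k i fun j _ _ => hi j (by omega) (by omega)⟩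
  | goto f => exact ⟨0, fun v S S' _ => ⟨rfl, rfl, fun k i hi => hi i (by omega) (by omega)⟩⟩
  | halt => exact ⟨0, fun v S S' _ => ⟨rfl, rfl, fun k i hi => hi i (by omega) (by omega)⟩⟩

/-- Since the set of states is finite, a statement pushes only finitely many symbols, although the
stack alphabets of the machine model may be infinite. -/
theorem exists_stepAux_symbols [Finite σ] (q : TM2.Stmt Γ Λ σ) : ∃ G₀ : ∀ k, Set (Γ k),
    (∀ k, (G₀ k).Finite) ∧ ∀ G : ∀ k, Set (Γ k), (∀ k, G₀ k ⊆ G k) →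
    ∀ (v : σ) (S : ∀ k, List (Γ k)), (∀ k, ∀ γ ∈ S k, γ ∈ G k) →
      ∀ k, ∀ γ ∈ (TM2.stepAux q v S).stk k, γ ∈ G k := by
  induction q with
  | push k₀ f q ih =>
    obtain ⟨G₀, hfin, h⟩ := ih
    refine ⟨fun k => G₀ k ∪ {γ | ∃ v, ∃ e : k₀ = k, e ▸ f v = γ}, fun k => ?_,
      fun G hG v S hS => h G (fun k => Set.subset_union_left.trans (hG k)) v _ ?_⟩
    · refine (hfin k).union ?_
      by_cases e : k₀ = k
      · subst e
        refine (Set.finite_range f).subset ?_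
        rintro _ ⟨v, _, rfl⟩
        exact ⟨v, rfl⟩
      · simp [e]
    · intro k γ hγ
      by_cases hk : k = k₀
      · subst hk
        simp only [Function.update_self, List.mem_cons] at hγ
        rcases hγ with rfl | hγ
        · exact hG k (Or.inr ⟨v, rfl, rfl⟩)
        · exact hS k γ hγ
      · rw [Function.update_of_ne hk] at hγ
        exact hS k γ hγ
  | peek k₀ f q ih =>
    obtain ⟨G₀, hfin, h⟩ := ih
    exact ⟨G₀, hfin, fun G hG v S hS => h G hG _ S hS⟩
  | pop k₀ f q ih =>
    obtain ⟨G₀, hfin, h⟩ := ih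
    refine ⟨G₀, hfin, fun G hG v S hS => h G hG _ _ ?_⟩
    intro k γ hγ
    by_cases hk : k = k₀
    · subst hk
      rw [Function.update_self] at hγ
      exact hS k γ (List.mem_of_mem_tail hγ)
    · rw [Function.update_of_ne hk] at hγ
      exact hS k γ hγ
  | load f q ih =>
    obtain ⟨G₀, hfin, h⟩ := ih
    exact ⟨G₀, hfin, fun G hG v S hS => h G hG _ S hS⟩
  | branch f q₁ q₂ ih₁ ih₂ =>
    obtain ⟨G₁, hfin₁, h₁⟩ := ih₁
    obtain ⟨G₂, hfin₂, h₂⟩ := ih₂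
    refine ⟨fun k => G₁ k ∪ G₂ k, fun k => (hfin₁ k).union (hfin₂ k), fun G hG v S hS => ?_⟩
    simp only [TM2.stepAux]
    cases f v with
    | true => exact h₁ G (fun k => Set.subset_union_left.trans (hG k)) v S hS
    | false => exact h₂ G (fun k => Set.subset_union_right.trans (hG k)) v S hS
  | goto f => exact ⟨fun _ => ∅, by simp, fun G _ v S hS => hS⟩
  | halt => exact ⟨fun _ => ∅, by simp, fun G _ v S hS => hS⟩

/-- One step of the machine, a halted configuration being kept. -/
def totalStep (M : Λ → TM2.Stmt Γ Λ σ) (c : TM2.Cfg Γ Λ σ) : TM2.Cfg Γ Λ σ :=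
  (TM2.step M c).getD c

theorem exists_totalStep_local [Finite Λ] (M : Λ → TM2.Stmt Γ Λ σ) : ∃ c : ℕ,
    ∀ x y : TM2.Cfg Γ Λ σ, x.l = y.l → x.var = y.var →
    (∀ k j, j < c → (x.stk k)[j]? = (y.stk k)[j]?) →
    (totalStep M x).l = (totalStep M y).l ∧ (totalStep M x).var = (totalStep M y).var ∧
    ∀ k i, (∀ j, i ≤ j + c → j ≤ i + c → (x.stk k)[j]? = (y.stk k)[j]?) →
      ((totalStep M x).stk k)[i]? = ((totalStep M y).stk k)[i]? := by
  choose c hc using fun l => exists_stepAux_local (M l)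
  obtain ⟨b, hb⟩ := (Set.finite_range c).bddAbove
  refine ⟨b, fun x y hl hv h => ?_⟩
  obtain ⟨lx, vx, Sx⟩ := x
  obtain ⟨ly, vy, Sy⟩ := y
  obtain rfl : lx = ly := hl
  obtain rfl : vx = vy := hv
  cases lx with
  | none => exact ⟨rfl, rfl, fun k i hi => hi i (by omega) (by omega)⟩
  | some l =>
    have hl := hb ⟨l, rfl⟩
    obtain ⟨h1, h2, h3⟩ := hc l vx Sx Sy fun k j hj => h k j (by omega)
    exact ⟨h1, h2, fun k i hi => h3 k i fun j _ _ => hi j (by omega) (by omega)⟩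

theorem exists_totalStep_symbols [Finite Λ] [Finite σ] (M : Λ → TM2.Stmt Γ Λ σ) :
    ∃ G₀ : ∀ k, Set (Γ k), (∀ k, (G₀ k).Finite) ∧ ∀ G : ∀ k, Set (Γ k), (∀ k, G₀ k ⊆ G k) →
    ∀ x : TM2.Cfg Γ Λ σ, (∀ k, ∀ γ ∈ x.stk k, γ ∈ G k) →
      ∀ k, ∀ γ ∈ (totalStep M x).stk k, γ ∈ G k := by
  choose G₀ hfin h using fun l => exists_stepAux_symbols (M l)
  refine ⟨fun k => ⋃ l, G₀ l k, fun k => Set.finite_iUnion fun l => hfin l k, ?_⟩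
  rintro G hG ⟨lx, vx, Sx⟩ hx
  cases lx with
  | none => exact hx
  | some l => exact h l G (fun k => (Set.subset_iUnion _ l).trans (hG k)) vx Sx hx

theorem totalStep_iterate_of_evals (M : Λ → TM2.Stmt Γ Λ σ) {b : TM2.Cfg Γ Λ σ} (k : ℕ) :
    ∀ {a : TM2.Cfg Γ Λ σ}, (flip bind (TM2.step M))^[k] (some a) = some b →
      (totalStep M)^[k] a = b := by
  have hnone : ∀ k, (flip bind (TM2.step M))^[k] (none : Option (TM2.Cfg Γ Λ σ)) = none :=
    fun k => Function.iterate_fixed rfl k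
  induction k with
  | zero => intro a h; simpa using h
  | succ k ih =>
    intro a h
    rw [Function.iterate_succ_apply] at h ⊢
    have e : flip bind (TM2.step M) (some a) = TM2.step M a := rfl
    rw [e] at h
    cases h' : TM2.step M a with
    | none => rw [h', hnone] at h; simp at h
    | some a' =>
      rw [h'] at h
      have : totalStep M a = a' := by simp [totalStep, h']
      rw [this]
      exact ih h

/-- The indices of the bits that describe a configuration, with stack symbols in `G`, up to depth `H`
of the stacks (one-hot encoding). -/
abbrev BitIdx (Λ σ : Type) {Γ : K → Type} (G : ∀ k, Set (Γ k)) (H : ℕ) : Type :=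
  Option Λ ⊕ σ ⊕ (Σ k, G k) × Fin H

open Classical in
/-- The bits of a configuration: its label, its state, and the symbols in the stack cells, which are
numbered from the top. -/
noncomputable def cfgBit {G : ∀ k, Set (Γ k)} {H : ℕ} (x : TM2.Cfg Γ Λ σ) : BitIdx Λ σ G H → Bool
  | .inl l => decide (x.l = l)
  | .inr (.inl v) => decide (x.var = v)
  | .inr (.inr (γ, j)) => decide ((x.stk γ.1)[(j : ℕ)]? = some γ.2.1)

theorem getElem?_eq_of_forall_mem {β : Type} {G : Set β} {a b : List β} (ha : ∀ γ ∈ a, γ ∈ G)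
    (hb : ∀ γ ∈ b, γ ∈ G) {j : ℕ} (h : ∀ γ ∈ G, a[j]? = some γ ↔ b[j]? = some γ) :
    a[j]? = b[j]? := by
  cases e : a[j]? with
  | some γ => exact ((h γ (ha γ (List.mem_of_getElem? e))).1 e).symm
  | none =>
    cases e' : b[j]? with
    | none => rfl
    | some γ => rw [(h γ (hb γ (List.mem_of_getElem? e'))).2 e'] at e; simp at e

variable [Finite K] [Finite Λ] [Finite σ]

/-- One machine step costs boundedly many gates for each bit. -/
theorem exists_reach_totalStep (M : Λ → TM2.Stmt Γ Λ σ) (G : ∀ k, Set (Γ k))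
    (hfin : ∀ k, (G k).Finite) : ∃ C c : ℕ, ∀ (X : Type) (cf : X → TM2.Cfg Γ Λ σ),
    (∀ x k, ∀ γ ∈ (cf x).stk k, γ ∈ G k) →
    ∀ H, Reach (Nat.card (BitIdx Λ σ G H) * C)
      (Set.range fun (i : BitIdx Λ σ G (H + c)) x => cfgBit (cf x) i)
      (Set.range fun (i : BitIdx Λ σ G H) x => cfgBit (totalStep M (cf x)) i) := by
  obtain ⟨c, hc⟩ := exists_totalStep_local M
  have : ∀ k, Finite (G k) := fun k => (hfin k).to_subtype
  -- the bits on which a bit of the next configuration depends: those of the label, the state, the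
  -- top `c` cells of each stack and the `2 * c + 1` cells around a given one
  let ι : Type := BitIdx Λ σ G c ⊕ (Σ k, G k) × Fin (2 * c + 1)
  obtain ⟨C, hC⟩ := exists_reach_of_determined ι
  refine ⟨C, c, fun X cf hcf H => Reach.range fun b => ?_⟩
  -- the depth of the cell, which plays no role for the bits of the label and of the state
  let r : ℕ := match b with
    | .inr (.inr (_, j)) => j
    | _ => 0
  let f : ι → X → Bool
    | .inl (.inl l) => fun x => cfgBit (cf x) (.inl l : BitIdx Λ σ G (H + c))
    | .inl (.inr (.inl v)) => fun x => cfgBit (cf x) (.inr (.inl v) : BitIdx Λ σ G (H + c))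
    | .inl (.inr (.inr (γ, j))) => fun x =>
      cfgBit (cf x) (.inr (.inr (γ, ⟨j, by omega⟩)) : BitIdx Λ σ G (H + c))
    | .inr (γ, j) => fun x => if h : r + j - c < H + c then
        cfgBit (cf x) (.inr (.inr (γ, ⟨r + j - c, h⟩)) : BitIdx Λ σ G (H + c))
      else cfgBit (cf x) (.inl none : BitIdx Λ σ G (H + c))
  refine hC X _ f ?_ _ ?_
  · rintro ((l | v | ⟨γ, j⟩) | ⟨γ, j⟩)
    · exact ⟨_, rfl⟩
    · exact ⟨_, rfl⟩
    · exact ⟨_, rfl⟩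
    · by_cases h : r + j - c < H + c
      · exact ⟨.inr (.inr (γ, ⟨r + j - c, h⟩)), by simp [f, h]⟩
      · exact ⟨.inl none, by simp [f, h]⟩
  intro x y hxy
  have hl : (cf x).l = (cf y).l := by
    have := hxy (.inl (.inl (cf y).l))
    simpa [f, cfgBit] using this
  have hv : (cf x).var = (cf y).var := by
    have := hxy (.inl (.inr (.inl (cf y).var)))
    simpa [f, cfgBit] using this
  have htop : ∀ k j, j < c → ((cf x).stk k)[j]? = ((cf y).stk k)[j]? := by
    intro k j hj
    refine getElem?_eq_of_forall_mem (hcf x k) (hcf y k) fun γ hγ => ?_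
    have := hxy (.inl (.inr (.inr (⟨k, γ, hγ⟩, ⟨j, hj⟩))))
    simpa [f, cfgBit] using this
  obtain ⟨h1, h2, h3⟩ := hc _ _ hl hv htop
  rcases b with l | v | ⟨⟨k, γ⟩, i⟩
  · simp [cfgBit, h1]
  · simp [cfgBit, h2]
  · have hri : r = i := rfl
    have := h3 k i fun j hj hj' => by
      refine getElem?_eq_of_forall_mem (hcf x k) (hcf y k) fun γ hγ => ?_
      have := hxy (.inr (⟨k, γ, hγ⟩, ⟨j + c - i, by omega⟩))
      have e : r + (j + c - i) - c = j := by omega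
      have hlt : j < H + c := by omega
      simpa [f, cfgBit, e, hlt] using this
    simp [cfgBit, this]

/-- Bits of the configuration after `T` steps, from those of the initial configuration in the
backward light cone. -/
theorem exists_reach_iterate (M : Λ → TM2.Stmt Γ Λ σ) (G : ∀ k, Set (Γ k))
    (hfin : ∀ k, (G k).Finite) (hG : ∀ x : TM2.Cfg Γ Λ σ, (∀ k, ∀ γ ∈ x.stk k, γ ∈ G k) →
      ∀ k, ∀ γ ∈ (totalStep M x).stk k, γ ∈ G k) :
    ∃ C c : ℕ, ∀ (X : Type) (cf : X → TM2.Cfg Γ Λ σ),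
    (∀ x k, ∀ γ ∈ (cf x).stk k, γ ∈ G k) →
    ∀ T H, Reach (T * (Nat.card (BitIdx Λ σ G (H + c * T)) * C))
      (Set.range fun (i : BitIdx Λ σ G (H + c * T)) x => cfgBit (cf x) i)
      (Set.range fun (i : BitIdx Λ σ G H) x => cfgBit ((totalStep M)^[T] (cf x)) i) := by
  obtain ⟨C, c, h⟩ := exists_reach_totalStep M G hfin
  have : ∀ k, Finite (G k) := fun k => (hfin k).to_subtype
  refine ⟨C, c, fun X cf hcf T => ?_⟩
  have hT : ∀ T x k, ∀ γ ∈ ((totalStep M)^[T] (cf x)).stk k, γ ∈ G k := by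
    intro T x
    induction T with
    | zero => exact hcf x
    | succ T ih => rw [Function.iterate_succ_apply']; exact hG _ ih
  induction T with
  | zero => exact fun H => (Reach.refl _ le_rfl).mono (by simp) le_rfl le_rfl
  | succ T ih =>
    intro H
    have h1 := ih (H + c)
    have h2 := h X (fun x => (totalStep M)^[T] (cf x)) (hT T) H
    simp only [← Function.iterate_succ_apply'] at h2
    have e : H + c + c * T = H + c * (T + 1) := by ring
    rw [e] at h1
    refine (h1.trans h2).mono ?_ le_rfl le_rfl
    have hcard : Nat.card (BitIdx Λ σ G H) ≤ Nat.card (BitIdx Λ σ G (H + c * (T + 1))) := by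
      simp only [BitIdx, Nat.card_sum, Nat.card_prod, Nat.card_fin]
      gcongr
      omega
    calc _ ≤ T * (Nat.card (BitIdx Λ σ G (H + c * (T + 1))) * C)
          + Nat.card (BitIdx Λ σ G (H + c * (T + 1))) * C := by gcongr
      _ = _ := by ring

end Machine

/-- A polynomial-time Turing machine has NOR circuits of polynomial size. -/
theorem PolyTimeComputable.exists_norCircuit {d m : ℕ} {F : (n mo : ℕ) → Code d n → Code m mo}
    (hF : PolyTimeComputable F) : ∃ q : Polynomial ℕ, ∀ n mo : ℕ,
      ∃ C : NorCircuit (d * n) (m * mo), C.size ≤ q.eval (n + mo) ∧ d * n ≤ C.size ∧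
        C.toDAG.eval = F n mo := by
  obtain ⟨M, p, hM⟩ := hF
  have := M.tm.kFin
  have := M.tm.ΛFin
  have := M.tm.σFin
  have fin₀ : Finite (M.tm.Γ M.tm.k₀) := Finite.of_equiv _ M.inputAlphabet.symm
  have fin₁ : Finite (M.tm.Γ M.tm.k₁) := Finite.of_equiv _ M.outputAlphabet.symm
  obtain ⟨G₀, hfin₀, hG₀⟩ := exists_totalStep_symbols M.tm.m
  -- all symbols that can occur, together with the output symbols
  let G : ∀ k, Set (M.tm.Γ k) := fun k => G₀ k ∪ {_γ | k = M.tm.k₀ ∨ k = M.tm.k₁}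
  have hfin : ∀ k, (G k).Finite := by
    intro k
    refine (hfin₀ k).union ?_
    by_cases h : k = M.tm.k₀ ∨ k = M.tm.k₁
    · have : Finite (M.tm.Γ k) := by
        rcases h with rfl | rfl
        exacts [fin₀, fin₁]
      exact Set.toFinite _
    · simp [h]
  have : ∀ k, Finite (G k) := fun k => (hfin k).to_subtype
  obtain ⟨C, c, hC⟩ := exists_reach_iterate M.tm.m G hfin
    (hG₀ G fun k => Set.subset_union_left)
  obtain ⟨C₁, hC₁⟩ := exists_reach_of_determined Unit
  let a : ℕ := Nat.card (Option M.tm.Λ) + Nat.card M.tm.σ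
  let g : ℕ := Nat.card (Σ k, G k)
  have hcard : ∀ H, Nat.card (BitIdx M.tm.Λ M.tm.σ G H) = a + g * H := by
    intro H
    simp only [BitIdx, Nat.card_sum, Nat.card_prod, Nat.card_fin, a, g]
    ring
  open Polynomial in
  refine ⟨(Polynomial.C a + Polynomial.C g * (Polynomial.C m * X + Polynomial.C c * p)) *
    (Polynomial.C (C₁ + 3) + p * Polynomial.C C) + Polynomial.C (d + 2 * m) * X, fun n mo => ?_⟩
  let T := p.eval (n + mo)
  let H := m * mo
  let cf : Code d n → Turing.TM2.Cfg M.tm.Γ M.tm.Λ M.tm.σ := fun u =>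
    Turing.initList M.tm ((inputWord u mo).map M.inputAlphabet.symm)
  have hstk : ∀ u, (cf u).stk M.tm.k₀ = (inputWord u mo).map M.inputAlphabet.symm := fun u => by
    simp [cf, Turing.initList]
  have hstk' : ∀ u k, k ≠ M.tm.k₀ → (cf u).stk k = [] := fun u k hk => by
    simp [cf, Turing.initList, hk]
  have hcf : ∀ u k, ∀ γ ∈ (cf u).stk k, γ ∈ G k := by
    intro u k γ hγ
    by_cases hk : k = M.tm.k₀
    · exact Or.inr (Or.inl hk)
    · rw [hstk' u k hk] at hγ; simp at hγ
  let A₀ : Set (Code d n → Bool) := Set.range fun (i : Fin (d * n)) (u : Code d n) => u i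
  -- a bit of the initial configuration is constant or depends on one input bit
  have hinit : Reach ((a + g * (H + c * T)) * (C₁ + 3)) A₀
      (Set.range fun (i : BitIdx M.tm.Λ M.tm.σ G (H + c * T)) u => cfgBit (cf u) i) := by
    rw [← hcard]
    refine Reach.range fun b => ?_
    by_cases hb : ∀ u, cfgBit (cf u) b = cfgBit (cf fun _ => false) b
    · simp only [hb]
      exact (reach_const A₀ _).mono (by omega) le_rfl le_rfl
    · rcases b with l | v | ⟨⟨k, γ⟩, j⟩
      · exact absurd (fun u => rfl) hb
      · exact absurd (fun u => rfl) hb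
      · by_cases hk : k = M.tm.k₀
        · subst hk
          by_cases hj : (j : ℕ) < d * n
          · refine (hC₁ _ A₀ (fun _ u => u ⟨j, hj⟩) (fun _ => ⟨_, rfl⟩) _ ?_).mono (by omega)
              le_rfl le_rfl
            intro x y hxy
            have : x ⟨j, hj⟩ = y ⟨j, hj⟩ := hxy ()
            simp [cfgBit, hstk, inputWord, List.getElem?_append, hj, this]
          · refine absurd (fun u => ?_) hb
            simp [cfgBit, hstk, inputWord, List.getElem?_append, hj]
        · refine absurd (fun u => ?_) hb
          simp [cfgBit, hstk' _ k hk]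
  have hout : ∀ u, (Turing.haltList M.tm ((List.ofFn (F n mo u)).map M.outputAlphabet.symm))
      = (totalStep M.tm.m)^[T] (cf u) := by
    intro u
    obtain ⟨⟨⟨steps, hsteps⟩, hle⟩⟩ := hM n mo u
    have h1 := totalStep_iterate_of_evals M.tm.m steps hsteps
    have h2 : T = (T - steps) + steps := (Nat.sub_add_cancel hle).symm
    rw [h2, Function.iterate_add_apply]
    refine Eq.trans ?_ (congrArg _ h1.symm)
    exact (Function.iterate_fixed rfl _).symm
  let o : Fin (m * mo) → Code d n → Bool := fun i u => F n mo u i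
  have hreach := (hinit.trans (hC _ cf hcf T H)).mono le_rfl le_rfl (B' := Set.range o) (by
    rintro _ ⟨i, rfl⟩
    refine ⟨.inr (.inr (⟨M.tm.k₁, M.outputAlphabet.symm true, Or.inr (Or.inr rfl)⟩, i)), ?_⟩
    funext u
    simp only [← hout u]
    simp only [cfgBit, Turing.haltList, o, dif_pos]
    simp
    exact fun _ => i.2)
  obtain ⟨D, hD1, hD2, hD3⟩ := ARLearn.exists_norCircuit hreach
  refine ⟨D, hD1.trans ?_, hD2, hD3⟩
  rw [hcard]
  simp only [Polynomial.eval_add, Polynomial.eval_mul, Polynomial.eval_C, Polynomial.eval_X]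
  have e : (a + g * (H + c * T)) * (C₁ + 3) + T * ((a + g * (H + c * T)) * C) + d * n
      + 2 * (m * mo) = (a + g * (m * mo + c * T)) * ((C₁ + 3) + T * C) + (d * n + 2 * m * mo) := by
    simp only [H]; ring
  rw [e]
  have h3 : d * n + 2 * m * mo ≤ (d + 2 * m) * (n + mo) := by
    nlinarith [Nat.zero_le (d * mo), Nat.zero_le (m * n)]
  have h4 : m * mo ≤ m * (n + mo) := by gcongr; omega
  gcongr

/-! ### The training program -/

/-- Hoare triples with a time bound. -/
def RamTriple (P : RamState → Prop) (p : RamProgram) (Q : RamState → Prop) (T : ℕ) : Prop :=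
  ∀ st, P st → Q (p.exec st).1 ∧ (p.exec st).2 ≤ T

theorem RamTriple.seq {P Q R : RamState → Prop} {p q : RamProgram} {T T' : ℕ}
    (h : RamTriple P p Q T) (h' : RamTriple Q q R T') : RamTriple P (.seq p q) R (T + T') :=
  fun st hst => ⟨(h' _ (h st hst).1).1, add_le_add (h st hst).2 (h' _ (h st hst).1).2⟩

/-- The loop rule, with an invariant indexed by the number of rounds. -/
theorem RamTriple.loop {I : ℕ → RamState → Prop} {a n T : ℕ} {p : RamProgram}
    (hn : ∀ st, I 0 st → st.reg a = n) (h : ∀ i < n, RamTriple (I i) p (I (i + 1)) T) :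
    RamTriple (I 0) (.loop a p) (I n) (n * (T + 1) + 1) := by
  intro st hst
  have key : ∀ i ≤ n, I i ((fun c : RamState × ℕ =>
      ((p.exec c.1).1, c.2 + (p.exec c.1).2 + 1))^[i] (st, 1)).1 ∧
      ((fun c : RamState × ℕ => ((p.exec c.1).1, c.2 + (p.exec c.1).2 + 1))^[i] (st, 1)).2
        ≤ i * (T + 1) + 1 := by
    intro i
    induction i with
    | zero => intro _; simpa using hst
    | succ i ih =>
      intro hi
      obtain ⟨h1, h2⟩ := ih (by omega)
      obtain ⟨h3, h4⟩ := h i (by omega) _ h1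
      rw [Function.iterate_succ_apply']
      refine ⟨h3, ?_⟩
      simp only
      rw [Nat.succ_mul]
      omega
  have := key n le_rfl
  simpa [RamProgram.exec, hn st hst] using this

open RamProgram

/-- One round over the training sequences: compare token `a` and token `b` of the current sequence
(at the addresses in registers `12` and `13`) with the token to be predicted (register `14`), raise
the flag in register `11` if the NOR of the former is not the latter, and go to the next sequence.
Writing register `21` serves as an empty branch. -/
def checkRound : RamProgram :=
  .seq (.load 15 0 12) <| .seq (.load 16 0 13) <| .seq (.load 17 0 14) <| .seq (.add 18 15 16) <|
  .seq (.ite 18 (.ite 17 (.const 11 1) (.const 21 0)) (.ite 17 (.const 21 0) (.const 11 1))) <|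
  .seq (.add 12 12 5) <| .seq (.add 13 13 5) (.add 14 14 5)

/-- Start of the comparison for the pair `a = reg 8`, `b = reg 9`. -/
def pairStart : RamProgram :=
  .seq (.const 11 0) <| .seq (.add 12 8 4) <| .seq (.add 13 9 4) (.add 14 6 4)

/-- If the pair fits, it is recorded in registers `19`, `20`. -/
def pairEnd : RamProgram :=
  .seq (.ite 11 (.const 21 0) (.seq (.add 19 8 4) (.add 20 9 4))) (.add 9 9 3)

/-- One candidate pair. -/
def pairRound : RamProgram :=
  .seq pairStart <| .seq (.loop 0 checkRound) pairEnd

/-- All candidates with first component `a`. -/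
def rowRound : RamProgram :=
  .seq (.const 9 0) <| .seq (.loop 6 pairRound) (.add 8 8 3)

/-- Start of the search at one position, with the fictitious parents `N + s`: this is the place of
the threshold in the row, so that the predictor stored if no pair fits has threshold `-1` and weights
`0`, and predicts `true`. -/
def positionStart : RamProgram :=
  .seq (.add 19 5 4) <| .seq (.add 20 5 4) (.const 8 0)

/-- The weights `-1` are stored at the recorded pair, and the next position is prepared. -/
def positionEnd : RamProgram :=
  .seq (.const 21 (-1)) <| .seq (.add 22 7 19) <| .seq (.store 1 22 21) <|
  .seq (.add 22 7 20) <| .seq (.store 1 22 21) <| .seq (.add 6 6 3) <|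
  .seq (.add 7 7 5) (.add 7 7 3)

/-- One position. -/
def positionRound : RamProgram :=
  .seq positionStart <| .seq (.loop 6 rowRound) positionEnd

/-- Initialization: the constants `1` and `0`, the length of a sequence, the first position. -/
def trainerStart : RamProgram :=
  .seq (.const 3 1) <| .seq (.const 4 0) <| .seq (.add 5 1 2) <| .seq (.add 6 1 4) (.const 7 0)

/-- The training program: at each position, exhaustive search for a NOR of two earlier tokens that
fits all training sequences. Register `6` holds the position, register `7` the start of the row of
the output. -/
def norTrainer : RamProgram :=
  .seq trainerStart (.loop 2 positionRound)

section Correctness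

variable {M L : ℕ} {X : ℕ → ℤ}

/-- The NOR of tokens `a` and `b` of sequence `i` is token `j`. -/
def NorOk (X : ℕ → ℤ) (L i a b j : ℕ) : Prop :=
  0 < X (i * L + a) + X (i * L + b) ↔ ¬ 0 < X (i * L + j)

/-- The registers and the array that are not changed during the search at position `j`. -/
structure SearchCtx (M L : ℕ) (X Y : ℕ → ℤ) (s t j : ℕ) (st : RamState) : Prop where
  h0 : st.reg 0 = M
  h2 : st.reg 2 = s
  h3 : st.reg 3 = 1
  h4 : st.reg 4 = 0
  h5 : st.reg 5 = L
  h6 : st.reg 6 = j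
  h7 : st.reg 7 = (t * (L + 1) : ℕ)
  hX : st.mem 0 = X
  hY : st.mem 1 = Y

/-- The recorded pair fits, or it is still the fictitious one and no pair tried so far fits. -/
def Best (M L : ℕ) (X : ℕ → ℤ) (j : ℕ) (tried : ℕ → ℕ → Prop) (st : RamState) : Prop :=
  ∃ p q : ℕ, st.reg 19 = p ∧ st.reg 20 = q ∧
    ((p < j ∧ q < j ∧ ∀ i < M, NorOk X L i p q j) ∨
      (p = L ∧ q = L ∧ ∀ a < j, ∀ b < j, tried a b → ¬ ∀ i < M, NorOk X L i a b j))

theorem Best.congr {j : ℕ} {tried tried' : ℕ → ℕ → Prop} {st st' : RamState}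
    (h : Best M L X j tried st) (h19 : st'.reg 19 = st.reg 19) (h20 : st'.reg 20 = st.reg 20)
    (ht : ∀ a < j, ∀ b < j, tried' a b → tried a b) : Best M L X j tried' st' := by
  obtain ⟨p, q, h1, h2, h3⟩ := h
  refine ⟨p, q, h19.trans h1, h20.trans h2, h3.imp id fun h => ⟨h.1, h.2.1, fun a ha b hb hab =>
    h.2.2 a ha b hb (ht a ha b hb hab)⟩⟩

/-- The state in the loop over the sequences, before sequence `i`. -/
structure CheckInv (M L : ℕ) (X Y : ℕ → ℤ) (s t j a b : ℕ) (i : ℕ) (st : RamState) : Prop where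
  ctx : SearchCtx M L X Y s t j st
  h8 : st.reg 8 = a
  h9 : st.reg 9 = b
  h12 : st.reg 12 = (i * L + a : ℕ)
  h13 : st.reg 13 = (i * L + b : ℕ)
  h14 : st.reg 14 = (i * L + j : ℕ)
  h11 : st.reg 11 ≤ 0 ↔ ∀ i' < i, NorOk X L i' a b j
  best : Best M L X j (fun a' b' => a' < a ∨ a' = a ∧ b' < b) st

theorem checkRound_spec {Y : ℕ → ℤ} {s t j a b i : ℕ} :
    RamTriple (CheckInv M L X Y s t j a b i) checkRound (CheckInv M L X Y s t j a b (i + 1)) 11 := by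
  rintro st ⟨⟨h0, h2, h3, h4, h5, h6, h7, hX, hY⟩, h8, h9, h12, h13, h14, h11, hb⟩
  have hsucc : (∀ i' < i + 1, NorOk X L i' a b j) ↔
      (∀ i' < i, NorOk X L i' a b j) ∧ NorOk X L i a b j := by
    simp only [Nat.lt_succ_iff_lt_or_eq, or_imp, forall_and, forall_eq]
  have e (c : ℕ) : ((i + 1) * L + c : ℕ) = ((i * L + c : ℕ) : ℤ) + L := by push_cast; ring
  by_cases c1 : 0 < X (i * L + a) + X (i * L + b) <;> by_cases c2 : 0 < X (i * L + j) <;>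
  by_cases hk : NorOk X L i a b j
  all_goals first
    | (exfalso; revert hk; simp [NorOk, c1, c2]; done)
    | skip
  all_goals
    simp only [checkRound, RamProgram.exec, h12, h13, h14, hX, Int.toNat_natCast, c1, c2, if_true,
      if_false, Function.update_self, ne_eq, Nat.reduceEqDiff,
      not_false_eq_true, Function.update_of_ne, h5]
    refine ⟨⟨⟨?_, ?_, ?_, ?_, ?_, ?_, ?_, ?_, ?_⟩, ?_, ?_, ?_, ?_, ?_, ?_, ?_⟩, ?_⟩
  all_goals first
    | exact hb.congr (by simp) (by simp) fun _ _ _ _ h => h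
    | (simp [*]; done)
    | (rw [hsucc]; simp [hk, h11])

/-- The state in the loop over the second component, before the pair `(a, b)`. -/
structure PairInv (M L : ℕ) (X Y : ℕ → ℤ) (s t j a : ℕ) (b : ℕ) (st : RamState) : Prop where
  ctx : SearchCtx M L X Y s t j st
  h8 : st.reg 8 = a
  h9 : st.reg 9 = b
  best : Best M L X j (fun a' b' => a' < a ∨ a' = a ∧ b' < b) st

theorem pairStart_spec {Y : ℕ → ℤ} {s t j a b : ℕ} :
    RamTriple (PairInv M L X Y s t j a b) pairStart (CheckInv M L X Y s t j a b 0) 4 := by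
  rintro st ⟨⟨h0, h2, h3, h4, h5, h6, h7, hX, hY⟩, h8, h9, hb⟩
  simp only [pairStart, RamProgram.exec]
  refine ⟨⟨⟨?_, ?_, ?_, ?_, ?_, ?_, ?_, ?_, ?_⟩, ?_, ?_, ?_, ?_, ?_, ?_, ?_⟩, ?_⟩
  all_goals first
    | exact hb.congr (by simp) (by simp) fun _ _ _ _ h => h
    | simp [*]

theorem pairEnd_spec {Y : ℕ → ℤ} {s t j a b : ℕ} (ha : a < j) (hbj : b < j) :
    RamTriple (CheckInv M L X Y s t j a b M) pairEnd (PairInv M L X Y s t j a (b + 1)) 4 := by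
  rintro st ⟨⟨h0, h2, h3, h4, h5, h6, h7, hX, hY⟩, h8, h9, h12, h13, h14, h11, hb⟩
  by_cases hok : ∀ i < M, NorOk X L i a b j
  · have hf : ¬ 0 < st.reg 11 := not_lt.2 (h11.2 hok)
    simp only [pairEnd, RamProgram.exec, hf, if_false]
    refine ⟨⟨⟨?_, ?_, ?_, ?_, ?_, ?_, ?_, ?_, ?_⟩, ?_, ?_, ?_⟩, ?_⟩
    all_goals first
      | (simp [*]; done)
      | exact ⟨a, b, by simp [*], by simp [*], Or.inl ⟨ha, hbj, hok⟩⟩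
  · have hf : 0 < st.reg 11 := not_le.1 fun h => hok (h11.1 h)
    simp only [pairEnd, RamProgram.exec, hf, if_true]
    refine ⟨⟨⟨?_, ?_, ?_, ?_, ?_, ?_, ?_, ?_, ?_⟩, ?_, ?_, ?_⟩, ?_⟩
    all_goals first
      | (simp [*]; done)
      | skip
    obtain ⟨p, q, h19, h20, h | ⟨hp, hq, h⟩⟩ := hb
    · exact ⟨p, q, by simp [h19], by simp [h20], Or.inl h⟩
    · refine ⟨p, q, by simp [h19], by simp [h20], Or.inr ⟨hp, hq, fun a' ha' b' hb' hab => ?_⟩⟩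
      by_cases hnew : a' = a ∧ b' = b
      · obtain ⟨rfl, rfl⟩ := hnew
        exact hok
      · exact h a' ha' b' hb' (by omega)

theorem pairRound_spec {Y : ℕ → ℤ} {s t j a b : ℕ} (ha : a < j) (hb : b < j) :
    RamTriple (PairInv M L X Y s t j a b) pairRound (PairInv M L X Y s t j a (b + 1))
      (12 * M + 9) := by
  have h := pairStart_spec.seq ((RamTriple.loop (I := CheckInv M L X Y s t j a b) (n := M) (a := 0)
    (fun st h => h.ctx.h0) fun i _ => checkRound_spec).seq (pairEnd_spec ha hb))
  exact fun st hst => ⟨(h st hst).1, (h st hst).2.trans (by omega)⟩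

/-- The state in the loop over the first component, before the pairs `(a, _)`. -/
structure RowInv (M L : ℕ) (X Y : ℕ → ℤ) (s t j : ℕ) (a : ℕ) (st : RamState) : Prop where
  ctx : SearchCtx M L X Y s t j st
  h8 : st.reg 8 = a
  best : Best M L X j (fun a' _ => a' < a) st

theorem rowRound_spec {Y : ℕ → ℤ} {s t j a : ℕ} (ha : a < j) :
    RamTriple (RowInv M L X Y s t j a) rowRound (RowInv M L X Y s t j (a + 1))
      (j * (12 * M + 10) + 3) := by
  have h1 : RamTriple (RowInv M L X Y s t j a) (.const 9 0) (PairInv M L X Y s t j a 0) 1 := by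
    rintro st ⟨⟨h0, h2, h3, h4, h5, h6, h7, hX, hY⟩, h8, hb⟩
    simp only [RamProgram.exec]
    refine ⟨⟨⟨?_, ?_, ?_, ?_, ?_, ?_, ?_, ?_, ?_⟩, ?_, ?_, ?_⟩, ?_⟩
    all_goals first
      | exact hb.congr (by simp) (by simp) fun _ _ _ _ h => by omega
      | simp [*]
  have h2 : RamTriple (PairInv M L X Y s t j a j) (.add 8 8 3) (RowInv M L X Y s t j (a + 1)) 1 := by
    rintro st ⟨⟨h0, h2, h3, h4, h5, h6, h7, hX, hY⟩, h8, h9, hb⟩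
    simp only [RamProgram.exec]
    refine ⟨⟨⟨?_, ?_, ?_, ?_, ?_, ?_, ?_, ?_, ?_⟩, ?_, ?_⟩, ?_⟩
    all_goals first
      | exact hb.congr (by simp) (by simp) fun _ _ _ _ h => by omega
      | simp [*]
  have h := h1.seq ((RamTriple.loop (I := PairInv M L X Y s t j a) (n := j) (a := 6)
    (fun st h => h.ctx.h6) fun b hb => pairRound_spec ha hb).seq h2)
  exact fun st hst => ⟨(h st hst).1, (h st hst).2.trans (le_of_eq (by ring))⟩

/-- Row `t` of the output describes a NOR of two tokens that fits, or it describes the constant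
`true` and no NOR of two tokens fits. -/
def RowOk (M L : ℕ) (X : ℕ → ℤ) (t j : ℕ) (Y : ℕ → ℤ) : Prop :=
  ∃ p q : ℕ, ((p < j ∧ q < j ∧ ∀ i < M, NorOk X L i p q j) ∨
      (p = L ∧ q = L ∧ ∀ a < j, ∀ b < j, ¬ ∀ i < M, NorOk X L i a b j)) ∧
    ∀ c ≤ L, Y (t * (L + 1) + c) = if c = p ∨ c = q then -1 else 0

/-- The state in the loop over the positions, before position `N + t`. -/
structure PositionInv (M N L : ℕ) (X : ℕ → ℤ) (s : ℕ) (t : ℕ) (st : RamState) : Prop where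
  ctx : SearchCtx M L X (st.mem 1) s t (N + t) st
  done : ∀ t' < t, RowOk M L X t' (N + t') (st.mem 1)
  fresh : ∀ c ≥ t * (L + 1), st.mem 1 c = 0

theorem positionStart_spec {Y : ℕ → ℤ} {s t j : ℕ} :
    RamTriple (SearchCtx M L X Y s t j) positionStart (RowInv M L X Y s t j 0) 3 := by
  rintro st ⟨h0, h2, h3, h4, h5, h6, h7, hX, hY⟩
  simp only [positionStart, RamProgram.exec]
  refine ⟨⟨⟨?_, ?_, ?_, ?_, ?_, ?_, ?_, ?_, ?_⟩, ?_, ?_⟩, ?_⟩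
  all_goals first
    | (simp [*]; done)
    | exact ⟨L, L, by simp [*], by simp [*], Or.inr ⟨rfl, rfl, by simp⟩⟩

theorem positionEnd_spec {Y : ℕ → ℤ} {N s t : ℕ} (ht : N + t < L)
    (hdone : ∀ t' < t, RowOk M L X t' (N + t') Y) (hfresh : ∀ c ≥ t * (L + 1), Y c = 0) :
    RamTriple (RowInv M L X Y s t (N + t) (N + t)) positionEnd (PositionInv M N L X s (t + 1)) 8 := by
  rintro st ⟨⟨h0, h2, h3, h4, h5, h6, h7, hX, hY⟩, h8, p, q, h19, h20, hpq⟩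
  have hp : p ≤ L := by rcases hpq with h | h <;> omega
  have hq : q ≤ L := by rcases hpq with h | h <;> omega
  have e19 : (st.reg 7 + st.reg 19).toNat = t * (L + 1) + p := by rw [h7, h19]; omega
  have e20 : (st.reg 7 + st.reg 20).toNat = t * (L + 1) + q := by rw [h7, h20]; omega
  have hrow : ∀ t' < t, t' * (L + 1) + L < t * (L + 1) := by
    intro t' h
    have : (t' + 1) * (L + 1) ≤ t * (L + 1) := Nat.mul_le_mul_right _ h
    linarith
  have hm : (positionEnd.exec st).1.mem 1
      = fun c => if c = t * (L + 1) + p ∨ c = t * (L + 1) + q then (-1 : ℤ) else Y c := by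
    simp [positionEnd, RamProgram.exec, e19, e20, hY]
    funext c
    by_cases h1 : c = t * (L + 1) + p <;> by_cases h2 : c = t * (L + 1) + q <;>
      simp [Function.update_apply, h1, h2]
  refine ⟨⟨⟨?_, ?_, ?_, ?_, ?_, ?_, ?_, ?_, rfl⟩, ?_, ?_⟩, le_refl 8⟩
  · simp [positionEnd, RamProgram.exec, h0]
  · simp [positionEnd, RamProgram.exec, h2]
  · simp [positionEnd, RamProgram.exec, h3]
  · simp [positionEnd, RamProgram.exec, h4]
  · simp [positionEnd, RamProgram.exec, h5]
  · simp [positionEnd, RamProgram.exec, h6, h3]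
    ring
  · simp [positionEnd, RamProgram.exec, h7, h5, h3]
    ring
  · simp [positionEnd, RamProgram.exec, hX]
  · intro t' ht'
    rw [hm]
    rcases Nat.lt_succ_iff_lt_or_eq.1 ht' with hlt | rfl
    · obtain ⟨p', q', h, hY'⟩ := hdone t' hlt
      refine ⟨p', q', h, fun c hc => ?_⟩
      have := hrow t' hlt
      rw [← hY' c hc]
      simp only
      rw [if_neg (by omega)]
    · refine ⟨p, q, hpq.imp id fun h => ⟨h.1, h.2.1, fun a ha b hb => h.2.2 a ha b hb ha⟩,
        fun c hc => ?_⟩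
      simp [hfresh (t' * (L + 1) + c) (by omega)]
  · intro c hc
    have hc' : t * (L + 1) + L < c := by rw [Nat.succ_mul] at hc; omega
    rw [hm]
    simp only
    rw [if_neg (by omega), hfresh c (by omega)]

/-- The running time of the training program: a polynomial in the number `M` of sequences, the
prompt length `N` and the number `s` of generated tokens. -/
def trainerTime (M N s : ℕ) : ℕ :=
  s * ((N + s) * ((N + s) * (12 * M + 10) + 4) + 13) + 6

theorem positionRound_spec {N s t : ℕ} (hL : L = N + s) (ht : t < s) :
    RamTriple (PositionInv M N L X s t) positionRound (PositionInv M N L X s (t + 1))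
      ((N + s) * ((N + s) * (12 * M + 10) + 4) + 12) := by
  intro st hst
  have h := positionStart_spec.seq ((RamTriple.loop
    (I := RowInv M L X (st.mem 1) s t (N + t)) (n := N + t) (a := 6)
    (fun st h => h.ctx.h6) fun a ha => rowRound_spec ha).seq
      (positionEnd_spec (by omega) hst.done hst.fresh)) st hst.ctx
  refine ⟨h.1, h.2.trans ?_⟩
  have := ht.le
  have : (N + t) * ((N + t) * (12 * M + 10) + 4)
      ≤ (N + s) * ((N + s) * (12 * M + 10) + 4) := by gcongr
  linarith

/-- The training program finds, at each position, a NOR gate that fits if there is one. -/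
theorem norTrainer_spec {N s : ℕ} (S : Fin M → Fin (N + s) → Bool) :
    (∀ t < s, RowOk M (N + s) ((trainInput S).mem 0) t (N + t)
      ((norTrainer.exec (trainInput S)).1.mem 1)) ∧
    (norTrainer.exec (trainInput S)).2 ≤ trainerTime M N s := by
  have h1 : RamTriple (fun st => st = trainInput S) trainerStart
      (PositionInv M N (N + s) ((trainInput S).mem 0) s 0) 5 := by
    rintro st rfl
    simp only [trainerStart, RamProgram.exec]
    refine ⟨⟨⟨?_, ?_, ?_, ?_, ?_, ?_, ?_, rfl, rfl⟩, ?_, ?_⟩, ?_⟩ <;> simp [trainInput]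
  obtain ⟨h2, h3⟩ := (h1.seq (RamTriple.loop (I := PositionInv M N (N + s) _ s) (n := s) (a := 2)
    (fun st h => h.ctx.h2) fun t ht => positionRound_spec rfl ht)) (trainInput S) rfl
  refine ⟨h2.done, h3.trans (le_of_eq ?_)⟩
  unfold trainerTime
  ring

end Correctness

/-- The token sequences of the training input. -/
theorem trainInput_mem {N s M : ℕ} (S : Fin M → Fin (N + s) → Bool) (i : Fin M) (j : Fin (N + s)) :
    (trainInput S).mem 0 (i * (N + s) + j) = if S i j then 1 else 0 := by
  have e : (i * (N + s) + j : ℕ) = (finProdFinEquiv (i, j) : Fin (M * (N + s))) := by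
    simp [finProdFinEquiv]; ring
  rw [e]
  simp only [trainInput, Fin.is_lt, and_self, dite_true, Fin.eta, Equiv.symm_apply_apply]

/-- If at every position the tokens of the training sequences are given by a NOR of at most two
earlier tokens, then training produces a `3`-sparse predictor without training error. -/
theorem trained_norTrainer {N s M : ℕ} (S : Fin M → Fin (N + s) → Bool)
    (P : (t : Fin s) → Finset (Fin (N + t))) (hP : ∀ t, (P t).card ≤ 2)
    (hS : ∀ i (t : Fin s), S i ⟨N + t, by omega⟩ = true ↔
      ∀ j ∈ P t, S i ⟨j, by omega⟩ = false) :
    (trained norTrainer S).Sparse ∧ (trained norTrainer S).Fits S ∧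
      trainTime norTrainer S ≤ trainerTime M N s := by
  obtain ⟨hrows, htime⟩ := norTrainer_spec S
  have hok : ∀ (t : Fin s) (p q : ℕ) (hp : p < N + t) (hq : q < N + t) (i : Fin M),
      NorOk ((trainInput S).mem 0) (N + s) i p q (N + t) ↔
        (S i ⟨N + t, by omega⟩ = true ↔
          S i ⟨p, by omega⟩ = false ∧ S i ⟨q, by omega⟩ = false) := by
    intro t p q hp hq i
    have e1 := trainInput_mem S i ⟨p, by omega⟩
    have e2 := trainInput_mem S i ⟨q, by omega⟩
    have e3 := trainInput_mem S i ⟨N + t, by omega⟩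
    simp only at e1 e2 e3
    rw [NorOk, e1, e2, e3]
    cases S i ⟨p, by omega⟩ <;> cases S i ⟨q, by omega⟩ <;> cases S i ⟨N + t, by omega⟩ <;> simp
  refine ⟨fun t => ?_, fun i t => ?_, htime⟩
  · obtain ⟨p, q, -, hY⟩ := hrows t t.2
    have hsub : {j | ((trained norTrainer S) t).weight j ≠ 0}
        ⊆ {j : Fin (N + t) | (j : ℕ) = p} ∪ {j : Fin (N + t) | (j : ℕ) = q} := by
      intro j hj
      by_contra hcon
      simp only [Set.mem_union, Set.mem_ofPred_eq] at hcon
      refine hj ?_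
      have := hY j (by have := j.2; omega)
      simp only [trained]
      rw [this, if_neg hcon]
      simp
    have hone : ∀ r : ℕ, {j : Fin (N + t) | (j : ℕ) = r}.ncard ≤ 1 := fun r =>
      (Set.ncard_le_one_iff (Set.toFinite _)).2 fun {a b} ha hb => Fin.ext (ha.trans hb.symm)
    calc _ ≤ _ := Set.ncard_le_ncard hsub (Set.toFinite _)
      _ ≤ _ := Set.ncard_union_le _ _
      _ ≤ 1 + 1 := add_le_add (hone p) (hone q)
      _ ≤ 3 := by omega
  · obtain ⟨p, q, hpq, hY⟩ := hrows t t.2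
    have hthr := hY (N + s) le_rfl
    have hw : ∀ j : Fin (N + t), ((trained norTrainer S) t).weight j
        = if (j : ℕ) = p ∨ (j : ℕ) = q then -1 else 0 := by
      intro j
      simp only [trained]
      rw [hY j (by have := j.2; omega)]
      split_ifs <;> simp
    rw [Bool.eq_iff_iff]
    simp only [LinearPredictor.predict, decide_eq_true_eq, hw]
    have hthr' : ((trained norTrainer S) t).threshold
        = if N + s = p ∨ N + s = q then -1 else 0 := by
      simp only [trained]
      rw [hthr]
      split_ifs <;> simp
    rw [hthr']
    rcases hpq with ⟨hp, hq, h⟩ | ⟨rfl, rfl, h⟩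
    · have := t.2
      rw [if_neg (by omega), (hok t p q hp hq i).1 (h i i.2)]
      have hle : ∀ j : Fin (N + t), (if S i ⟨j, by omega⟩ = true then
          if (j : ℕ) = p ∨ (j : ℕ) = q then (-1 : ℝ) else 0 else 0) ≤ 0 := by
        intro j; split_ifs <;> norm_num
      constructor
      · intro hsum
        have hz := (Finset.sum_eq_zero_iff_of_nonpos fun j _ => hle j).1
          (le_antisymm (Finset.sum_nonpos fun j _ => hle j) hsum)
        have h1 := hz ⟨p, hp⟩ (Finset.mem_univ _)
        have h2 := hz ⟨q, hq⟩ (Finset.mem_univ _)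
        simpa using And.intro h1 h2
      · rintro ⟨h1, h2⟩
        refine le_of_eq (Finset.sum_eq_zero fun j _ => ?_).symm
        by_cases hj : (j : ℕ) = p ∨ (j : ℕ) = q
        · rcases hj with hj | hj <;> simp [hj, h1, h2]
        · simp [hj]
    · rw [if_pos (by simp)]
      have hz : ∀ j : Fin (N + t), ¬ ((j : ℕ) = N + s) := fun j => by omega
      simp only [hz, or_self, if_false, ite_self, Finset.sum_const_zero]
      refine iff_of_true (by norm_num) ?_
      -- no NOR of two tokens fits, so that the gate has no parents
      have hempty : P t = ∅ := by
        by_contra hne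
        obtain ⟨a, b, hab⟩ : ∃ a b, P t = {a, b} := by
          have hpos := Finset.card_pos.2 (Finset.nonempty_iff_ne_empty.2 hne)
          have := hP t
          obtain h1 | h2 : (P t).card = 1 ∨ (P t).card = 2 := by omega
          · obtain ⟨a, ha⟩ := Finset.card_eq_one.1 h1
            exact ⟨a, a, by simp [ha]⟩
          · obtain ⟨a, b, -, hab⟩ := Finset.card_eq_two.1 h2
            exact ⟨a, b, hab⟩
        refine h a a.2 b b.2 fun i hi => (hok t a b a.2 b.2 ⟨i, hi⟩).2 ?_
        rw [hS ⟨i, hi⟩ t, hab]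
        simp
      rw [hS i t, hempty]
      simp

/-! ### The dataset -/

section Dataset

variable {N K : ℕ}

/-- Entry `a` of a sequence, `false` beyond its end. -/
def look {j : ℕ} (z : Fin j → Bool) (a : ℕ) : Bool := if h : a < j then z ⟨a, h⟩ else false

/-- The Boolean functions of three tokens of the prefix of length `N + t`, for all `t < s`. Missing
tokens are encoded by positions beyond the end of the prefix. -/
abbrev SparseTest (N s : ℕ) : Type := Fin s × (Fin 3 → Fin (N + s + 1)) × ((Fin 3 → Bool) → Bool)

/-- A test errs on an input if its value is not the gate value of the DAG. -/
def DAG.Errs (C : DAG N K) (τ : SparseTest N C.size) (u : Fin N → Bool) : Prop :=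
  τ.2.2 (fun k => look (C.trace u) (τ.2.1 k)) ≠ C.trace u ⟨N + τ.1, by omega⟩

open Classical in
/-- An input on which the test errs, if there is one. -/
noncomputable def DAG.witness (C : DAG N K) (τ : SparseTest N C.size) : Fin N → Bool :=
  if h : ∃ u, C.Errs τ u then h.choose else fun _ => false

open Classical in
/-- Traces that refute every wrong test (and one more trace, so that the set is not empty). -/
noncomputable def DAG.teachingSet (C : DAG N K) : Finset (Fin (N + C.size) → Bool) :=
  insert (C.trace fun _ => false) (Finset.univ.image fun τ => C.trace (C.witness τ))

theorem DAG.exists_of_mem_teachingSet {C : DAG N K} {z : Fin (N + C.size) → Bool}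
    (hz : z ∈ C.teachingSet) : ∃ u, z = C.trace u := by
  simp only [teachingSet, Finset.mem_insert, Finset.mem_image] at hz
  rcases hz with h | ⟨τ, -, h⟩
  exacts [⟨_, h⟩, ⟨_, h.symm⟩]

theorem DAG.card_teachingSet_le (C : DAG N K) :
    C.teachingSet.card ≤ C.size * ((N + C.size + 1) ^ 3 * 256) + 1 := by
  refine (Finset.card_insert_le _ _).trans (Nat.add_le_add_right (Finset.card_image_le.trans ?_) 1)
  simp

/-- A `3`-sparse linear predictor is a Boolean function of three tokens. -/
theorem LinearPredictor.exists_eq_look {j : ℕ} (h : LinearPredictor j)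
    (hs : {i | h.weight i ≠ 0}.ncard ≤ 3) : ∃ (a : Fin 3 → ℕ) (G : (Fin 3 → Bool) → Bool),
    (∀ k, a k ≤ j) ∧ ∀ z, h.predict z = G fun k => look z (a k) := by
  classical
  let W : Finset (Fin j) := Finset.univ.filter fun i => h.weight i ≠ 0
  have hW : W.card ≤ 3 := by
    rw [← Set.ncard_coe_finset]
    simpa [W] using hs
  let a : Fin 3 → ℕ := fun k => (W.toList.map Fin.val).getD k j
  have ha : ∀ i, h.weight i ≠ 0 → ∃ k, a k = i := by
    intro i hi
    have hm : (i : ℕ) ∈ W.toList.map Fin.val := by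
      simpa only [List.mem_map, Finset.mem_toList, W, Finset.mem_filter, Finset.mem_univ, true_and]
        using ⟨i, hi, rfl⟩
    obtain ⟨k, hk, e⟩ := List.getElem_of_mem hm
    have hk3 : k < 3 := by
      simp only [List.length_map, Finset.length_toList] at hk
      omega
    exact ⟨⟨k, hk3⟩, by simp only [a, List.getD_eq_getElem _ _ hk, e]⟩
  refine ⟨a, fun w => decide (h.threshold ≤
    ∑ i : Fin j, if ∃ k, a k = i ∧ w k = true then h.weight i else 0), fun k => ?_, fun z => ?_⟩
  · by_cases hk : (k : ℕ) < (W.toList.map Fin.val).length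
    · simp only [a, List.getD_eq_getElem _ _ hk, List.getElem_map]
      omega
    · simp only [a]
      rw [List.getD_eq_default _ _ (by omega)]
  · have hsum : (∑ i, if z i = true then h.weight i else 0)
        = ∑ i : Fin j, if ∃ k, a k = i ∧ look z (a k) = true then h.weight i else 0 := by
      refine Finset.sum_congr rfl fun i _ => ?_
      by_cases hi : h.weight i = 0
      · simp [hi]
      · obtain ⟨k, hk⟩ := ha i hi
        have : (∃ k, a k = i ∧ look z (a k) = true) ↔ z i = true := by
          constructor
          · rintro ⟨k', e, h'⟩
            simpa [e, look] using h'
          · intro h'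
            exact ⟨k, hk, by simpa [hk, look] using h'⟩
        simp only [this]
    rw [LinearPredictor.predict, Bool.eq_iff_iff, decide_eq_true_eq, decide_eq_true_eq, hsum]

/-- A sparse predictor without error on the teaching set generates the traces of the DAG. -/
theorem ARPredictor.generate_eq_trace {C : DAG N K} {h : ARPredictor N C.size} {M : ℕ}
    {S : Fin M → Fin (N + C.size) → Bool} (hS : ∀ w ∈ C.teachingSet, ∃ i, S i = w)
    (hs : h.Sparse) (hf : h.Fits S) (u : Fin N → Bool) : h.generate u = C.trace u := by
  refine unroll_eq (fun i => unroll_of_lt u C.size _ i) fun t => ?_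
  obtain ⟨a, G, ha, hG⟩ := (h t).exists_eq_look (hs t)
  -- a missing token, encoded by the position just behind the prefix, is moved behind the sequence
  let a' : Fin 3 → Fin (N + C.size + 1) := fun k =>
    if a k < N + t then ⟨a k, by have := t.2; have := ha k; omega⟩ else Fin.last _
  have hlook : ∀ (z : Fin (N + C.size) → Bool) k,
      look (fun j : Fin (N + t) => z ⟨j, by omega⟩) (a k) = look z (a' k) := by
    intro z k
    have := t.2
    by_cases hk : a k < N + t
    · have : a k < N + C.size := by omega
      simp [look, a', hk, this]
    · simp [look, a', hk]
  by_contra hne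
  have hex : ∃ u, C.Errs (t, a', G) u := by
    refine ⟨u, fun he => hne ?_⟩
    rw [hG]
    simp only [hlook]
    exact he.symm
  have hw : C.witness (t, a', G) = hex.choose := dif_pos hex
  obtain ⟨i, hi⟩ := hS (C.trace (C.witness (t, a', G))) (by
    simp only [DAG.teachingSet, Finset.mem_insert, Finset.mem_image]
    exact Or.inr ⟨_, Finset.mem_univ _, rfl⟩)
  refine hex.choose_spec ?_
  have := hf i t
  rw [hG] at this
  simp only [hlook, hi, hw] at this
  exact this

end Dataset

/-! ### Sampling -/

/-- Coupon collector: independent samples from the uniform distribution on `k` points contain all of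
them, except with probability `k * exp (-M / k)`. -/
theorem le_measure_forall_exists_eq {Ω : Type} [MeasurableSpace Ω] [MeasurableSingletonClass Ω]
    [Finite Ω] (W : Finset Ω) (hW : W.Nonempty) {δ : ℝ} (hδ : 0 < δ) {M : ℕ}
    (hM : W.card * (W.card + ⌈Real.log (1 / δ)⌉₊) ≤ M) :
    ENNReal.ofReal (1 - δ) ≤
      (Measure.pi fun _ : Fin M => (PMF.uniformOfFinset W hW).toMeasure)
        {S | ∀ w ∈ W, ∃ i, S i = w} := by
  set D := PMF.uniformOfFinset W hW
  set μ := Measure.pi fun _ : Fin M => D.toMeasure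
  set k := W.card
  have hk : (0 : ℝ) < k := by exact_mod_cast hW.card_pos
  have hone : ∀ w ∈ W, D.toMeasure {w}ᶜ ≤ ENNReal.ofReal (Real.exp (-1 / k)) := by
    intro w hw
    rw [prob_compl_eq_one_sub (measurableSet_singleton w),
      PMF.toMeasure_apply_singleton _ _ (measurableSet_singleton w),
      PMF.uniformOfFinset_apply_of_mem hW hw]
    have e : (1 : ENNReal) - ((k : ENNReal))⁻¹ = ENNReal.ofReal (1 - (k : ℝ)⁻¹) := by
      rw [ENNReal.ofReal_sub _ (by positivity), ENNReal.ofReal_one, ENNReal.ofReal_inv_of_pos hk,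
        ENNReal.ofReal_natCast]
    rw [e]
    refine ENNReal.ofReal_le_ofReal ?_
    have := Real.add_one_le_exp (-1 / (k : ℝ))
    rw [neg_div, one_div] at this ⊢
    linarith
  have hbad : ∀ w ∈ W, μ {S | ∀ i, S i ≠ w} ≤ ENNReal.ofReal (Real.exp (-1 / k)) ^ M := by
    intro w hw
    have e : {S : Fin M → Ω | ∀ i, S i ≠ w} = Set.pi Set.univ fun _ => {w}ᶜ := by
      ext S; simp
    rw [e, Measure.pi_pi]
    refine (Finset.prod_le_prod' fun i _ => hone w hw).trans ?_
    simp
  have hcompl : μ {S | ∀ w ∈ W, ∃ i, S i = w}ᶜ ≤ ENNReal.ofReal δ := by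
    have e : {S : Fin M → Ω | ∀ w ∈ W, ∃ i, S i = w}ᶜ = ⋃ w ∈ W, {S | ∀ i, S i ≠ w} := by
      ext S; simp
    rw [e]
    refine (measure_biUnion_finset_le W _).trans ((Finset.sum_le_sum hbad).trans ?_)
    rw [Finset.sum_const, nsmul_eq_mul, ← ENNReal.ofReal_pow (Real.exp_pos _).le,
      ← Real.exp_nat_mul, ← ENNReal.ofReal_natCast, ← ENNReal.ofReal_mul (by positivity)]
    refine ENNReal.ofReal_le_ofReal ?_
    change (k : ℝ) * _ ≤ δ
    have hM' : (k : ℝ) * (k + Real.log (1 / δ)) ≤ M := by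
      calc (k : ℝ) * (k + Real.log (1 / δ)) ≤ k * (k + (⌈Real.log (1 / δ)⌉₊ : ℝ)) := by
            gcongr; exact Nat.le_ceil _
        _ ≤ M := by exact_mod_cast hM
    have hexp : (M : ℝ) * (-1 / k) ≤ -k + Real.log δ := by
      rw [one_div, Real.log_inv] at hM'
      have : (k : ℝ) + -Real.log δ ≤ M / k := by
        rw [le_div_iff₀ hk]; linarith
      have e : (M : ℝ) * (-1 / k) = -(M / k) := by ring
      rw [e]; linarith
    calc (k : ℝ) * Real.exp (M * (-1 / k)) ≤ Real.exp k * Real.exp (-k + Real.log δ) := by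
          gcongr
          have := Real.add_one_le_exp (k : ℝ)
          linarith
      _ = δ := by rw [← Real.exp_add, add_neg_cancel_left, Real.exp_log hδ]
  have hmeas : MeasurableSet {S : Fin M → Ω | ∀ w ∈ W, ∃ i, S i = w} :=
    (Set.toFinite _).measurableSet
  rw [ENNReal.ofReal_sub _ hδ.le, ENNReal.ofReal_one]
  have := prob_compl_eq_one_sub (μ := μ) hmeas.compl
  rw [compl_compl] at this
  rw [this]
  exact tsub_le_tsub_left hcompl 1

/-! ### The neural network -/

theorem ofBits_eq_sum {n : ℕ} (c : Fin n → Bool) :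
    (Nat.ofBits c : ℝ) = ∑ i : Fin n, 2 ^ (i : ℕ) * (if c i then 1 else 0) := by
  induction n with
  | zero => simp
  | succ n ih =>
    rw [Nat.ofBits_succ, Fin.sum_univ_succ]
    push_cast
    rw [ih, Finset.mul_sum, add_comm]
    congr 1
    · cases c 0 <;> simp
    · refine Finset.sum_congr rfl fun i _ => ?_
      simp only [Function.comp, Fin.val_succ, pow_succ]
      ring

theorem ReluNet.depth_le {N m : ℕ} (Φ : ReluNet N m) : Φ.depth ≤ Φ.hidden + 1 := by
  classical
  unfold ReluNet.depth
  exact Nat.add_le_add_right (unroll_sup_le Φ.hidden _) 1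

theorem ncard_fin_le {j : ℕ} (A : Set (Fin j)) : A.ncard ≤ j := by
  simpa [Set.ncard_univ] using Set.ncard_le_ncard (Set.subset_univ A)

theorem ReluNet.size_le {N m : ℕ} (Φ : ReluNet N m) :
    Φ.size ≤ Φ.hidden + m + Φ.hidden * (N + Φ.hidden) + m * (N + Φ.hidden) := by
  unfold ReluNet.size
  gcongr
  · refine (Finset.sum_le_card_nsmul _ _ (N + Φ.hidden) fun t _ => ?_).trans (by simp)
    exact (ncard_fin_le _).trans (by omega)
  · exact (Finset.sum_le_card_nsmul _ _ (N + Φ.hidden) fun t _ => ncard_fin_le _).trans (by simp)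

namespace NorCircuit

variable {N m mo : ℕ}

open Classical in
/-- The network of a NOR circuit: a NOR gate is the ReLU unit `max 0 (1 - ∑ parents)`, and the output
layer decodes the binary output numbers. -/
noncomputable def reluNet (C : NorCircuit N (m * mo)) (lo width : Fin m → ℝ) : ReluNet N m where
  hidden := C.size
  weight t j := if j ∈ C.parents t then -1 else 0
  bias _ := 1
  outWeight k i := ∑ b : Fin mo,
    if i = ⟨N + (C.size - m * mo) + (finProdFinEquiv (k, b) : Fin (m * mo)),
        by have := C.le_size; omega⟩ then width k * (2 ^ (b : ℕ) / 2 ^ mo) else 0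
  outBias := lo

theorem eval_reluNet (C : NorCircuit N (m * mo)) (lo width : Fin m → ℝ) (u : Fin N → Bool) :
    (C.reluNet lo width).eval (bitsToReal u) = outDecode lo width (C.toDAG.eval u : Code m mo) := by
  classical
  have hunits : unroll (bitsToReal u) C.size (fun t z =>
      max 0 (1 + ∑ j, (if j ∈ C.parents t then (-1 : ℝ) else 0) * z j))
      = bitsToReal (C.values u) := by
    refine unroll_eq (fun i => ?_) fun t => ?_
    · simp only [bitsToReal]
      rw [C.values_of_lt u i]
    · have htr := C.values_add u t
      simp only [bitsToReal, ite_mul, zero_mul, Finset.sum_ite_mem, Finset.univ_inter]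
      by_cases h : ∀ i ∈ C.parents t, C.values u ⟨i, by omega⟩ = false
      · rw [if_pos (htr.2 h), Finset.sum_eq_zero fun i hi => by rw [h i hi]; simp]
        simp
      · rw [if_neg fun h' => h (htr.1 h'), eq_comm, max_eq_left_iff]
        push Not at h
        obtain ⟨i, hi, hti⟩ := h
        rw [ne_eq, Bool.not_eq_false] at hti
        have hle := Finset.single_le_sum (s := C.parents t)
          (f := fun i : Fin (N + t) => -((-1 : ℝ) *
            if C.values u ⟨i, by omega⟩ = true then 1 else 0))
          (fun j _ => by split_ifs <;> norm_num) hi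
        rw [Finset.sum_neg_distrib] at hle
        simp only [hti, if_true] at hle
        linarith
  funext k
  change lo k + ∑ i : Fin (N + C.size), (∑ b : Fin mo,
    if i = ⟨N + (C.size - m * mo) + (finProdFinEquiv (k, b) : Fin (m * mo)), _⟩
      then width k * (2 ^ (b : ℕ) / 2 ^ mo) else 0) * unroll (bitsToReal u) C.size (fun t z =>
      max 0 (1 + ∑ j, (if j ∈ C.parents t then (-1 : ℝ) else 0) * z j)) i = _
  rw [hunits]
  simp only [outDecode, bitValue, ofBits_eq_sum]
  congr 1
  simp only [Finset.sum_mul, ite_mul, zero_mul]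
  rw [Finset.sum_comm, Finset.sum_div, Finset.mul_sum]
  refine Finset.sum_congr rfl fun b _ => ?_
  rw [Finset.sum_ite_eq' Finset.univ, if_pos (Finset.mem_univ _)]
  change _ = width k * (2 ^ (b : ℕ) * (if C.values u
    ⟨N + (C.size - m * mo) + (finProdFinEquiv (k, b) : Fin (m * mo)), _⟩ = true then 1 else 0)
    / 2 ^ mo)
  simp only [bitsToReal]
  ring

end NorCircuit

/-! ### Polynomial bounds -/

/-- A bound for the cardinality of the teaching set of a DAG of size at most `x`, with at most as many
inputs as gates. -/
noncomputable def teachingPoly : Polynomial ℕ :=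
  .X * ((2 * .X + 1) ^ 3 * 256) + 1

/-- A bound for the sample size. -/
noncomputable def samplePoly : Polynomial ℕ := teachingPoly * (teachingPoly + .X)

/-- A bound for the training time. -/
noncomputable def timePoly : Polynomial ℕ :=
  .X * (2 * .X * (2 * .X * (12 * samplePoly + 10) + 4) + 13) + 6

theorem card_teachingSet_le_eval {N K : ℕ} (C : DAG N K) (hN : N ≤ C.size) {x : ℕ}
    (hx : C.size ≤ x) : C.teachingSet.card ≤ teachingPoly.eval x := by
  refine C.card_teachingSet_le.trans ?_
  have : N + C.size ≤ 2 * x := by omega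
  simp only [teachingPoly, Polynomial.eval_add, Polynomial.eval_mul, Polynomial.eval_pow,
    Polynomial.eval_X, Polynomial.eval_one, Polynomial.eval_ofNat]
  gcongr

theorem trainerTime_le_eval {M N s x : ℕ} (hN : N ≤ s) (hx : s ≤ x)
    (hM : M ≤ samplePoly.eval x) : trainerTime M N s ≤ timePoly.eval x := by
  have : N + s ≤ 2 * x := by omega
  simp only [timePoly, trainerTime, Polynomial.eval_add, Polynomial.eval_mul,
    Polynomial.eval_X, Polynomial.eval_ofNat]
  gcongr

end ARLearn

theorem mainTheorem2 :
    -- a single training algorithm and a single polynomial serve all targets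
    ∃ (A : RamProgram) (P : Polynomial ℕ),
    ∀ (d m : ℕ) (f : (Fin d → unitInterval) → (Fin m → ℝ)) (lo width : Fin m → ℝ)
      (F : (n mo : ℕ) → Code d n → Code m mo),
    IsPrecisionFamily lo width f F → PolyTimeComputable F →
    ∃ (C : (n mo : ℕ) → DAG (d * n) (m * mo)) (q : Polynomial ℕ),
    ∀ n mo : ℕ,
      -- the computation DAG of `F n mo`
      (C n mo).eval = F n mo ∧
      (C n mo).size ≤ q.eval (n + mo) ∧ (C n mo).depth ≤ q.eval (n + mo) ∧
      -- the dataset: a distribution on sequences recording computations of the DAG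
      ∃ D : PMF (Fin (d * n + (C n mo).size) → Bool),
        (∀ z ∈ D.support, ∃ u, z = (C n mo).trace u) ∧
        ∀ δ : ℝ, 0 < δ → δ < 1 →
          -- sample complexity
          ∃ M : ℕ, M ≤ P.eval ((C n mo).size + ⌈Real.log (1 / δ)⌉₊ + mo) ∧
          -- training on a sample succeeds, in polynomial time
          (∀ S : Fin M → Fin (d * n + (C n mo).size) → Bool, (∀ i, S i ∈ D.support) →
            (trained A S).Sparse ∧ (trained A S).Fits S ∧
            trainTime A S ≤ P.eval ((C n mo).size + ⌈Real.log (1 / δ)⌉₊ + mo)) ∧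
          -- with probability at least `1 - δ`, all predictors without training error compute
          -- `F n mo`, and compose to an accurate neural network of polynomial size and depth
          ∀ M' ≥ M,
            ENNReal.ofReal (1 - δ) ≤ (Measure.pi fun _ : Fin M' => D.toMeasure)
              {S | ∀ h : ARPredictor (d * n) (C n mo).size, h.Sparse → h.Fits S →
                (∀ u, h.answer (m * mo) (C n mo).le_size u = F n mo u) ∧
                ∃ Φ : ReluNet (d * n) m,
                  Φ.size ≤ q.eval (n + mo) ∧ Φ.depth ≤ q.eval (n + mo) ∧
                  (∀ u, Φ.eval (bitsToReal u) =
                    outDecode lo width (h.answer (m * mo) (C n mo).le_size u : Code m mo)) ∧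
                  ∀ x : Fin d → unitInterval,
                    ‖Φ.eval (bitsToReal (inQuant n x)) - f (gridPoint (inQuant n x))‖
                      ≤ (2 : ℝ)⁻¹ ^ mo} := by
  refine ⟨norTrainer, samplePoly + timePoly, fun d m f lo width F hF hpoly => ?_⟩
  obtain ⟨q, hq⟩ := hpoly.exists_norCircuit
  choose C hsize hN heval using hq
  refine ⟨fun n mo => (C n mo).toDAG,
    q + 1 + (q + .C m + q * (2 * q) + .C m * (2 * q)), fun n mo => ?_⟩
  have hqle : q.eval (n + mo) + 1 ≤
      (q + 1 + (q + .C m + q * (2 * q) + .C m * (2 * q))).eval (n + mo) := by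
    simp only [Polynomial.eval_add, Polynomial.eval_one]
    omega
  refine ⟨heval n mo, ?_, ?_, PMF.uniformOfFinset (C n mo).toDAG.teachingSet
    (Finset.insert_nonempty _ _), ?_, fun δ hδ _ => ?_⟩
  · exact (hsize n mo).trans ((Nat.le_succ _).trans hqle)
  · exact (C n mo).depth_toDAG_le.trans ((hsize n mo).trans ((Nat.le_succ _).trans hqle))
  · intro z hz
    exact DAG.exists_of_mem_teachingSet ((PMF.mem_support_uniformOfFinset_iff _ _).1 hz)
  set W := (C n mo).toDAG.teachingSet
  set x := (C n mo).toDAG.size + ⌈Real.log (1 / δ)⌉₊ + mo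
  have hsx : (C n mo).size ≤ x := (Nat.le_add_right _ _).trans (Nat.le_add_right _ _)
  have hlx : ⌈Real.log (1 / δ)⌉₊ ≤ x := (Nat.le_add_left _ _).trans (Nat.le_add_right _ _)
  have hM : W.card * (W.card + ⌈Real.log (1 / δ)⌉₊) ≤ samplePoly.eval x := by
    have hW : W.card ≤ teachingPoly.eval x := card_teachingSet_le_eval _ (hN n mo) hsx
    simp only [samplePoly, Polynomial.eval_mul, Polynomial.eval_add, Polynomial.eval_X]
    gcongr
  refine ⟨W.card * (W.card + ⌈Real.log (1 / δ)⌉₊), ?_, fun S hS => ?_, fun M' hM' => ?_⟩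
  · rw [Polynomial.eval_add]
    exact hM.trans (Nat.le_add_right _ _)
  · obtain ⟨h1, h2, h3⟩ := trained_norTrainer (s := (C n mo).size) S (C n mo).parents
      (C n mo).card_parents_le fun i t => by
        obtain ⟨u, hu⟩ := DAG.exists_of_mem_teachingSet
          ((PMF.mem_support_uniformOfFinset_iff _ _).1 (hS i))
        have e : S i = (C n mo).values u := hu
        rw [e]
        exact (C n mo).values_add u t
    refine ⟨h1, h2, h3.trans ?_⟩
    rw [Polynomial.eval_add]
    exact (trainerTime_le_eval (hN n mo) hsx hM).trans (Nat.le_add_left _ _)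
  · refine (le_measure_forall_exists_eq W _ hδ hM').trans (measure_mono ?_)
    intro S hS h hsparse hfits
    have hans : ∀ u, h.answer (m * mo) (C n mo).toDAG.le_size u = F n mo u := by
      intro u
      rw [← heval n mo, ARPredictor.answer, ARPredictor.generate_eq_trace hS hsparse hfits]
      rfl
    have hΦ : ∀ u : Code d n, ((C n mo).reluNet lo width).eval (bitsToReal u)
        = outDecode lo width (F n mo u) := fun u => by
      rw [← heval n mo]
      exact (C n mo).eval_reluNet lo width u
    refine ⟨hans, (C n mo).reluNet lo width, ?_, ?_, fun u => ?_, fun x => ?_⟩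
    · refine (ReluNet.size_le _).trans ?_
      have h1 : ((C n mo).reluNet lo width).hidden ≤ q.eval (n + mo) := hsize n mo
      have h2 : d * n + ((C n mo).reluNet lo width).hidden ≤ 2 * q.eval (n + mo) := by
        have := (hN n mo).trans (hsize n mo)
        omega
      simp only [Polynomial.eval_add, Polynomial.eval_mul, Polynomial.eval_C, Polynomial.eval_ofNat]
      refine le_add_left ?_
      gcongr
    · exact (ReluNet.depth_le _).trans ((Nat.add_le_add_right (hsize n mo) 1).trans hqle)
    · rw [hans, hΦ]
    · rw [hΦ]
      exact hF n mo _
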